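/- Theorem. Let $M$ be a smooth finite-dimensional Hausdorff manifold with a pseudo-Riemannian metric $g$ (a smooth field of symmetric nondegenerate bilinear forms $g_q$ on the tangent spaces $T_qM$), let $\nabla$ be its Levi-Civita connection and $R(X,Y)Z=\nabla_X\nabla_YZ-\nabla_Y\nabla_XZ-\nabla_{[X,Y]}Z$ its curvature. Let $p\in M$ and let $\exp_p(v)=\gamma_v(1)$ be the exponential map, where $\gamma_v$ is the geodesic with $\gamma_v(0)=p$ and $\gamma_v'(0)=v$. Let $U\subseteq T_pM$ be an open convex neighbourhood of $0$ that is contained in the domain of $\exp_p$ and such that $\exp_p$ restricted to $U$ is a smooth diffeomorphism onto an open subset $\exp_p(U)$ of $M$. Regard $T_pM$ as a manifold with the constant metric $g_p$. Then $\exp_p:U\to\exp_p(U)$ is an isometry, i.e. it is a diffeomorphism with $$g_{\exp_p(v)}\big(D(\exp_p)_v w,\,D(\exp_p)_v z\big)=g_p(w,z)\qquad\text{for all } v\in U,\ w,z\in T_pM,$$ if and only if the curvature vanishes on $\exp_p(U)$, i.e. $(R(X,Y)Z)(q)=0$ for all $q\in\exp_p(U)$ and all smooth vector fields $X,Y,Z$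 on $M$. -/

import Mathlib

open Set
open scoped Manifold ContDiff Topology

set_option linter.unusedSectionVars false

noncomputable section

/-- A pseudo-Riemannian metric on a smooth manifold `M` (modelled on the real normed space `E`):
a smooth section of symmetric nondegenerate bilinear forms on the tangent spaces. For a
finite-dimensional `E` injectivity of `v ↦ g(v, ·)` is nondegeneracy. No signature is prescribed. -/
structure PseudoRiemannianMetric (E : Type*) [NormedAddCommGroup E] [NormedSpace ℝ E]
    (M : Type*) [TopologicalSpace M] [ChartedSpace E M] [IsManifold 𝓘(ℝ, E) ∞ M] where
  val (q : M) : TangentSpace 𝓘(ℝ, E) q →L[ℝ] TangentSpace 𝓘(ℝ, E) q →L[ℝ] ℝ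
  symm (q : M) (v w : TangentSpace 𝓘(ℝ, E) q) : val q v w = val q w v
  nondegenerate (q : M) (v : TangentSpace 𝓘(ℝ, E) q) (hv : ∀ w, val q v w = 0) : v = 0
  contMDiff : ContMDiff 𝓘(ℝ, E) (𝓘(ℝ, E).prod 𝓘(ℝ, E →L[ℝ] E →L[ℝ] ℝ)) ∞
    (fun q ↦ Bundle.TotalSpace.mk' (E →L[ℝ] E →L[ℝ] ℝ)
      (E := fun q : M ↦ TangentSpace 𝓘(ℝ, E) q →L[ℝ] TangentSpace 𝓘(ℝ, E) q →L[ℝ] ℝ) q (val q))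

variable {E : Type*} [NormedAddCommGroup E] [NormedSpace ℝ E]
    {M : Type*} [TopologicalSpace M] [ChartedSpace E M] [IsManifold 𝓘(ℝ, E) ∞ M]

/-- The coordinate representation of the vector field `σ` in the preferred chart at `x`, as an
`E`-valued function of the point `z` (meaningful for `z` in the chart domain). -/
def fieldCoord (x : M) (σ : Π z : M, TangentSpace 𝓘(ℝ, E) z) (z : M) : E :=
  (trivializationAt E (TangentSpace 𝓘(ℝ, E)) x ⟨z, σ z⟩).2

namespace PseudoRiemannianMetric

/-- The matrix `g_ij` of the metric in the preferred chart at `x`, as a function of the point `z`: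
the bilinear form `(u, v) ↦ g_z(∂_u, ∂_v)` with `∂_u`, `∂_v` the coordinate vector fields. At `z = x`
the chart identification of the tangent space with `E` is the identity. -/
def coord (g : PseudoRiemannianMetric E M) (x z : M) : E →L[ℝ] E →L[ℝ] ℝ :=
  let B : E →L[ℝ] E →L[ℝ] ℝ := g.val z
  let A : E →L[ℝ] E := (trivializationAt E (TangentSpace 𝓘(ℝ, E)) x).symmL ℝ z
  B.bilinearComp A A

/-- The first derivatives of the metric coefficients at `x` in the preferred chart at `x`:
`g.coordDeriv x u v w` is `∂_u (g(∂_v, ∂_w))` at `x`. -/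
def coordDeriv (g : PseudoRiemannianMetric E M) (x : M) : E →L[ℝ] E →L[ℝ] E →L[ℝ] ℝ :=
  mvfderiv 𝓘(ℝ, E) (g.coord x) x

/-- The Christoffel symbols of the first kind at `x`:
`Γ(u, v; w) = (1/2) (∂_u g(v, w) + ∂_v g(u, w) - ∂_w g(u, v))`. -/
def christoffelFirst (g : PseudoRiemannianMetric E M) (x : M) (u v : E) : E →L[ℝ] ℝ :=
  (2⁻¹ : ℝ) • (g.coordDeriv x u v + g.coordDeriv x v u - ((g.coordDeriv x).flip u).flip v)

/-- The Christoffel symbols `Γ(u, v)` at `x` in the preferred chart at `x`, defined by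
`g(Γ(u, v), w) = (1/2) (∂_u g(v, w) + ∂_v g(u, w) - ∂_w g(u, v))` for all `w`; see
`coord_christoffel` for this identity. -/
def christoffel (g : PseudoRiemannianMetric E M) (x : M) (u v : E) : E :=
  (g.coord x x).inverse (g.christoffelFirst x u v)

lemma christoffelFirst_apply (g : PseudoRiemannianMetric E M) (x : M) (u v w : E) :
    g.christoffelFirst x u v w = 2⁻¹ * (g.coordDeriv x u v w
      + g.coordDeriv x v u w - g.coordDeriv x w u v) := by
  simp [christoffelFirst]

lemma christoffel_add_left (g : PseudoRiemannianMetric E M) (x : M) (u u' v : E) :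
    g.christoffel x (u + u') v = g.christoffel x u v + g.christoffel x u' v := by
  unfold christoffel
  rw [← map_add]
  congr 1
  ext w
  simp only [christoffelFirst_apply, map_add, add_apply]
  ring

lemma christoffel_smul_left (g : PseudoRiemannianMetric E M) (x : M) (c : ℝ) (u v : E) :
    g.christoffel x (c • u) v = c • g.christoffel x u v := by
  unfold christoffel
  rw [← map_smul]
  congr 1
  ext w
  simp only [christoffelFirst_apply, map_smul, smul_apply, smul_eq_mul]
  ring

lemma contMDiffAt_coord (g : PseudoRiemannianMetric E M) (x : M) :
    ContMDiffAt 𝓘(ℝ, E) 𝓘(ℝ, E →L[ℝ] E →L[ℝ] ℝ) ∞ (g.coord x) x := by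
  have h := g.contMDiff x
  rw [Bundle.contMDiffAt_section] at h
  refine h.congr_of_eventuallyEq ?_
  have := (trivializationAt E (TangentSpace 𝓘(ℝ, E)) x).open_baseSet.mem_nhds
    (FiberBundle.mem_baseSet_trivializationAt E _ x)
  filter_upwards [this] with z hz
  ext u v
  have hz' : z ∈ (trivializationAt ℝ (fun _ : M ↦ ℝ) x).baseSet := mem_univ z
  refine Eq.trans ?_ (inCoordinates_apply_eq₂ (F₁ := E) (F₂ := E) (F₃ := ℝ)
    (E₁ := (TangentSpace 𝓘(ℝ, E) : M → Type _)) (E₂ := (TangentSpace 𝓘(ℝ, E) : M → Type _))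
    (E₃ := fun _ ↦ ℝ) (ϕ := g.val z) (v := u) (w := v) hz hz hz').symm
  have h1 := (trivializationAt E (TangentSpace 𝓘(ℝ, E)) x).symmL_apply (R := ℝ) hz u
  have h2 := (trivializationAt E (TangentSpace 𝓘(ℝ, E)) x).symmL_apply (R := ℝ) hz v
  rw [← h1, ← h2]
  simp
  rfl

lemma hasMFDerivAt_coord (g : PseudoRiemannianMetric E M) (x : M) :
    HasMFDerivAt 𝓘(ℝ, E) 𝓘(ℝ, E →L[ℝ] E →L[ℝ] ℝ) (g.coord x) x (g.coordDeriv x) :=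
  ((g.contMDiffAt_coord x).mdifferentiableAt (by simp)).hasMFDerivAt

lemma coord_symm (g : PseudoRiemannianMetric E M) (x z : M) (u v : E) :
    g.coord x z u v = g.coord x z v u := g.symm z _ _

lemma coordDeriv_symm (g : PseudoRiemannianMetric E M) (x : M) (u v w : E) :
    g.coordDeriv x u v w = g.coordDeriv x u w v := by
  have h (v w : E) : HasMFDerivAt 𝓘(ℝ, E) 𝓘(ℝ, ℝ) (fun z ↦ g.coord x z v w) x
      ((ContinuousLinearMap.apply ℝ ℝ w ∘L ContinuousLinearMap.apply ℝ (E →L[ℝ] ℝ) v) ∘L g.coordDeriv x) :=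
    ((ContinuousLinearMap.apply ℝ ℝ w ∘L ContinuousLinearMap.apply ℝ (E →L[ℝ] ℝ) v).hasMFDerivAt).comp x (g.hasMFDerivAt_coord x)
  have h1 := h v w
  rw [show (fun z ↦ g.coord x z v w) = fun z ↦ g.coord x z w v from
    funext fun z ↦ g.coord_symm x z v w] at h1
  exact congr($(hasMFDerivAt_unique h1 (h w v)) u)

lemma christoffel_symm (g : PseudoRiemannianMetric E M) (x : M) (u v : E) :
    g.christoffel x u v = g.christoffel x v u := by
  unfold christoffel
  congr 1
  ext w
  simp only [christoffelFirst_apply]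
  have : g.coordDeriv x w u v = g.coordDeriv x w v u := g.coordDeriv_symm x w u v
  rw [this]; ring

end PseudoRiemannianMetric

lemma fieldCoord_self (x : M) (σ : Π z : M, TangentSpace 𝓘(ℝ, E) z) :
    fieldCoord x σ x = σ x := by
  unfold fieldCoord
  rw [TangentBundle.trivializationAt_apply]
  have := tangentCoordChange_self (I := 𝓘(ℝ, E)) (x := x) (z := x) (v := σ x) (by simp)
  exact this

lemma symmL_self (x : M) :
    (trivializationAt E (TangentSpace 𝓘(ℝ, E)) x).symmL ℝ x = (ContinuousLinearMap.id ℝ E) := by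
  rw [TangentBundle.symmL_trivializationAt_eq_core (by simp)]
  ext v
  exact tangentCoordChange_self (I := 𝓘(ℝ, E)) (x := x) (z := x) (v := v) (by simp)

lemma mdiff_fieldCoord {x : M} {σ : Π z : M, TangentSpace 𝓘(ℝ, E) z} 
   (h : MDiffAt (T% σ) x) : MDiffAt (fieldCoord x σ) x := by
  rwa [mdifferentiableAt_section] at h

lemma fieldCoord_add (x : M) (σ τ : Π z : M, TangentSpace 𝓘(ℝ, E) z) :
   fieldCoord x (σ + τ) =ᶠ[𝓝 x] fieldCoord x σ + fieldCoord x τ := by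
  have := (trivializationAt E (TangentSpace 𝓘(ℝ, E)) x).open_baseSet.mem_nhds (FiberBundle.mem_baseSet_trivializationAt E _ x)
  filter_upwards [this] with z hz
  exact ((trivializationAt E (TangentSpace 𝓘(ℝ, E)) x).linear ℝ hz).map_add _ _

lemma fieldCoord_smul (x : M) (f : M → ℝ) (σ : Π z : M, TangentSpace 𝓘(ℝ, E) z) :
   fieldCoord x (f • σ) =ᶠ[𝓝 x] fun z => f z • fieldCoord x σ z := by
  have := (trivializationAt E (TangentSpace 𝓘(ℝ, E)) x).open_baseSet.mem_nhds (FiberBundle.mem_baseSet_trivializationAt E _ x)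
  filter_upwards [this] with z hz
  exact ((trivializationAt E (TangentSpace 𝓘(ℝ, E)) x).linear ℝ hz).map_smul _ _

/-- The ordinary derivative at `x` of the coordinate representation of `σ` in the preferred chart
at `x`. -/
def fieldDeriv (x : M) (σ : Π z : M, TangentSpace 𝓘(ℝ, E) z) : E →L[ℝ] E :=
  mvfderiv 𝓘(ℝ, E) (fieldCoord x σ) x

lemma fieldDeriv_add {x : M} {σ τ : Π z : M, TangentSpace 𝓘(ℝ, E) z}
    (hσ : MDiffAt (T% σ) x) (hτ : MDiffAt (T% τ) x) :
    fieldDeriv x (σ + τ) = fieldDeriv x σ + fieldDeriv x τ := by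
  have h : mvfderiv 𝓘(ℝ, E) (fieldCoord x (σ + τ)) x
      = mvfderiv 𝓘(ℝ, E) (fieldCoord x σ) x + mvfderiv 𝓘(ℝ, E) (fieldCoord x τ) x := by
    rw [← mvfderiv_add (mdiff_fieldCoord hσ) (mdiff_fieldCoord hτ)]
    exact (fieldCoord_add x σ τ).mfderiv_eq
  exact h

lemma fieldDeriv_smul {x : M} {f : M → ℝ} {σ : Π z : M, TangentSpace 𝓘(ℝ, E) z}
    (hf : MDiffAt f x) (hσ : MDiffAt (T% σ) x) (u : E) :
    letI s : E := σ x
    fieldDeriv x (f • σ) u = f x • fieldDeriv x σ u + mvfderiv 𝓘(ℝ, E) f x u • s := by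
  have h : mvfderiv 𝓘(ℝ, E) (fieldCoord x (f • σ)) x
      = f x • mvfderiv 𝓘(ℝ, E) (fieldCoord x σ) x
        + (mvfderiv 𝓘(ℝ, E) f x).smulRight (fieldCoord x σ x) := by
    rw [← mvfderiv_fun_smul hf (mdiff_fieldCoord hσ)]
    exact (fieldCoord_smul x f σ).mfderiv_eq
  rw [fieldCoord_self] at h
  exact congr($h u)

lemma symmL_fieldCoord {x z : M}
    (hz : z ∈ (trivializationAt E (TangentSpace 𝓘(ℝ, E)) x).baseSet)
    (σ : Π z : M, TangentSpace 𝓘(ℝ, E) z) :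
    (trivializationAt E (TangentSpace 𝓘(ℝ, E)) x).symmL ℝ z (fieldCoord x σ z) = σ z := by
  rw [Bundle.Trivialization.symmL_apply _ hz]
  exact (trivializationAt E (TangentSpace 𝓘(ℝ, E)) x).symm_apply_apply_mk hz (σ z)

lemma PseudoRiemannianMetric.coord_apply (g : PseudoRiemannianMetric E M) (x z : M) (u v : E) :
    g.coord x z u v = g.val z ((trivializationAt E (TangentSpace 𝓘(ℝ, E)) x).symmL ℝ z u)
      ((trivializationAt E (TangentSpace 𝓘(ℝ, E)) x).symmL ℝ z v) := rfl

lemma extend_coord (x : M) (u : TangentSpace 𝓘(ℝ, E) x) (z : M) :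
    FiberBundle.extend E u z
      = (trivializationAt E (TangentSpace 𝓘(ℝ, E)) x).symm z u := by
  have h := fieldCoord_self x (FiberBundle.extend E u)
  rw [FiberBundle.extend_apply_self] at h
  unfold FiberBundle.extend
  congr 1
  have h2 : fieldCoord x (FiberBundle.extend E u) x
    = (trivializationAt E (TangentSpace 𝓘(ℝ, E)) x ⟨x, u⟩).2 := by
    unfold fieldCoord
    rw [FiberBundle.extend_apply_self]
  exact h2.symm.trans h

lemma fieldDeriv_extend (x : M) (u : TangentSpace 𝓘(ℝ, E) x) :
    fieldDeriv x (FiberBundle.extend E u) = 0 := by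
  have h : fieldCoord x (FiberBundle.extend E u) =ᶠ[𝓝 x] fun _ ↦ (u : E) := by
    have := (trivializationAt E (TangentSpace 𝓘(ℝ, E)) x).open_baseSet.mem_nhds
      (FiberBundle.mem_baseSet_trivializationAt E _ x)
    filter_upwards [this] with z hz
    rw [fieldCoord, extend_coord]
    exact congr(($((trivializationAt E (TangentSpace 𝓘(ℝ, E)) x).apply_mk_symm hz u)).2)
  exact h.mfderiv_eq.trans (mvfderiv_const (M := M) (I := 𝓘(ℝ, E)) (F := E) u)

lemma mlieBracket_extend (x : M) (u v : TangentSpace 𝓘(ℝ, E) x) :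
    VectorField.mlieBracket 𝓘(ℝ, E) (FiberBundle.extend E u) (FiberBundle.extend E v) x = 0 := by
  have h (u : TangentSpace 𝓘(ℝ, E) x) :
      VectorField.mpullbackWithin 𝓘(ℝ, E) 𝓘(ℝ, E) (extChartAt 𝓘(ℝ, E) x).symm
        (FiberBundle.extend E u) (range 𝓘(ℝ, E)) =ᶠ[𝓝 (extChartAt 𝓘(ℝ, E) x x)]
      fun _ ↦ (u : E) := by
    filter_upwards [extChartAt_target_mem_nhds (I := 𝓘(ℝ, E)) x] with y hy
    have hz : (extChartAt 𝓘(ℝ, E) x).symm y ∈ (chartAt E x).source := by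
      simpa using (extChartAt 𝓘(ℝ, E) x).map_target hy
    have h1 := TangentBundle.symmL_trivializationAt (I := 𝓘(ℝ, E)) hz
    rw [(extChartAt 𝓘(ℝ, E) x).right_inv hy] at h1
    have h2 := (trivializationAt E (TangentSpace 𝓘(ℝ, E)) x).symmL_apply (R := ℝ) hz u
    have h3 := isInvertible_mfderivWithin_extChartAt_symm (I := 𝓘(ℝ, E)) hy
    rw [VectorField.mpullbackWithin_apply, extend_coord]
    refine (congrArg _ (h2.symm.trans congr($h1 u))).trans ?_
    exact h3.inverse_apply_self _
  have key (V W : E → E) (s : Set E) (y a b : E) (hV : V =ᶠ[𝓝 y] fun _ ↦ a)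
      (hW : W =ᶠ[𝓝 y] fun _ ↦ b) : VectorField.lieBracketWithin ℝ V W s y = 0 := by
    rw [VectorField.lieBracketWithin_eq]
    have h1 := hV.filter_mono (nhdsWithin_le_nhds (s := s))
    have h2 := hW.filter_mono (nhdsWithin_le_nhds (s := s))
    simp [h1.fderivWithin_eq hV.eq_of_nhds, h2.fderivWithin_eq hW.eq_of_nhds]
  rw [VectorField.mlieBracket, VectorField.mlieBracketWithin_apply]
  exact (congrArg _ (key _ _ _ _ _ _ (h u) (h v))).trans (map_zero _)

lemma hasMFDerivAt_clm_apply {F₁ F₂ : Type*} [NormedAddCommGroup F₁] [NormedSpace ℝ F₁]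
    [NormedAddCommGroup F₂] [NormedSpace ℝ F₂] {x : M} {f : M → F₁ →L[ℝ] F₂} {v : M → F₁}
    {f' : E →L[ℝ] F₁ →L[ℝ] F₂} {v' : E →L[ℝ] F₁}
    (hf : HasMFDerivAt 𝓘(ℝ, E) 𝓘(ℝ, F₁ →L[ℝ] F₂) f x f')
    (hv : HasMFDerivAt 𝓘(ℝ, E) 𝓘(ℝ, F₁) v x v') :
    HasMFDerivAt 𝓘(ℝ, E) 𝓘(ℝ, F₂) (fun z ↦ f z (v z)) x
      ((f x).comp v' + f'.flip (v x) : E →L[ℝ] F₂) := by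
  refine ⟨hf.1.clm_apply hv.1, ?_⟩
  have h := hf.2.clm_apply hv.2
  simp only [writtenInExtChartAt, Function.comp_apply, extChartAt_to_inv] at h
  exact h

namespace PseudoRiemannianMetric

/-- The field of bilinear forms on the vector space `E` with the constant value `B`. -/
def constForm (B : E →L[ℝ] E →L[ℝ] ℝ) (q : E) :
    TangentSpace 𝓘(ℝ, E) q →L[ℝ] TangentSpace 𝓘(ℝ, E) q →L[ℝ] ℝ := B

lemma contMDiff_constForm (B : E →L[ℝ] E →L[ℝ] ℝ) :
    ContMDiff 𝓘(ℝ, E) (𝓘(ℝ, E).prod 𝓘(ℝ, E →L[ℝ] E →L[ℝ] ℝ)) ∞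
      (fun q ↦ Bundle.TotalSpace.mk' (E →L[ℝ] E →L[ℝ] ℝ)
        (E := fun q : E ↦ TangentSpace 𝓘(ℝ, E) q →L[ℝ] TangentSpace 𝓘(ℝ, E) q →L[ℝ] ℝ) q
        (constForm B q)) := by
  intro x
  rw [Bundle.contMDiffAt_section]
  refine (contMDiffAt_const (c := B)).congr_of_eventuallyEq (Filter.Eventually.of_forall fun z ↦ ?_)
  ext u v
  have hz : z ∈ (trivializationAt E (TangentSpace 𝓘(ℝ, E)) x).baseSet := mem_univ z
  have hz' : z ∈ (trivializationAt ℝ (fun _ : E ↦ ℝ) x).baseSet := mem_univ z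
  refine (inCoordinates_apply_eq₂ (F₁ := E) (F₂ := E) (F₃ := ℝ)
    (E₁ := (TangentSpace 𝓘(ℝ, E) : E → Type _)) (E₂ := (TangentSpace 𝓘(ℝ, E) : E → Type _))
    (E₃ := fun _ ↦ ℝ) (ϕ := constForm B z) (v := u) (w := v) hz hz hz').trans ?_
  have h1 := (trivializationAt E (TangentSpace 𝓘(ℝ, E)) x).symmL_apply (R := ℝ) hz u
  have h2 := (trivializationAt E (TangentSpace 𝓘(ℝ, E)) x).symmL_apply (R := ℝ) hz v
  rw [← h1, ← h2, TangentBundle.symmL_model_space]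
  simp
  rfl

/-- The constant pseudo-Riemannian metric on the vector space `E`, given by a symmetric
nondegenerate bilinear form `B`. -/
def constMetric (B : E →L[ℝ] E →L[ℝ] ℝ) (hsymm : ∀ v w, B v w = B w v)
    (hnondeg : ∀ v, (∀ w, B v w = 0) → v = 0) : PseudoRiemannianMetric E E where
  val := constForm B
  symm _ := hsymm
  nondegenerate _ := hnondeg
  contMDiff := contMDiff_constForm B

variable [FiniteDimensional ℝ E]

/-- The Levi-Civita connection of `g`: `∇_u σ = ∂_u σ + Γ(u, σ)` in the preferred chart at the
base point. It is metric (`leviCivita_metric`) and torsion-free (`leviCivita_torsionFree`), and these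
two properties characterise it. -/
def leviCivita (g : PseudoRiemannianMetric E M) :
    CovariantDerivative 𝓘(ℝ, E) E (TangentSpace 𝓘(ℝ, E) : M → Type _) where
  toFun σ x :=
    let Γ : E →ₗ[ℝ] E :=
      { toFun u := g.christoffel x u (σ x)
        map_add' u u' := g.christoffel_add_left x u u' (σ x)
        map_smul' c u := g.christoffel_smul_left x c u (σ x) }
    (fieldDeriv x σ + LinearMap.toContinuousLinearMap Γ : E →L[ℝ] E)
  isCovariantDerivativeOnUniv := by
    constructor
    · intro σ τ x hσ hτ _
      have key (S A B : E →L[ℝ] E) (h : S = A + B) (s t u : E) :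
          S u + g.christoffel x u (s + t)
            = (A u + g.christoffel x u s) + (B u + g.christoffel x u t) := by
        rw [h, christoffel_symm, christoffel_add_left, christoffel_symm (v := s),
          christoffel_symm (v := t), add_apply]
        abel
      exact ContinuousLinearMap.ext fun u ↦ key _ _ _ (fieldDeriv_add hσ hτ) (σ x) (τ x) u
    · intro σ f x hσ hf _
      have key (S A : E →L[ℝ] E) (c d : ℝ) (s u : E) (h : S u = c • A u + d • s) :
          S u + g.christoffel x u (c • s) = c • (A u + g.christoffel x u s) + d • s := by
        rw [h, christoffel_symm, christoffel_smul_left, christoffel_symm (v := s)]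
        module
      exact ContinuousLinearMap.ext fun u ↦ key _ _ _ _ (σ x) u (fieldDeriv_smul hf hσ u)

lemma leviCivita_apply (g : PseudoRiemannianMetric E M) (σ : Π z : M, TangentSpace 𝓘(ℝ, E) z)
    (x : M) (u : E) :
    g.leviCivita σ x u = fieldDeriv x σ u + g.christoffel x u (σ x) := rfl

lemma isInvertible_coord (g : PseudoRiemannianMetric E M) (x : M) :
    (g.coord x x).IsInvertible := by
  have hz : x ∈ (trivializationAt E (TangentSpace 𝓘(ℝ, E)) x).baseSet :=
    FiberBundle.mem_baseSet_trivializationAt E _ x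
  have hinj : Function.Injective (g.coord x x : E →ₗ[ℝ] E →L[ℝ] ℝ) := by
    rw [injective_iff_map_eq_zero]
    intro v hv
    refine g.nondegenerate x v fun w ↦ ?_
    have h := congr($hv w)
    change (g.coord x x v) w = 0 at h
    rw [coord, symmL_self] at h
    exact h
  have hd : Module.finrank ℝ E = Module.finrank ℝ (E →L[ℝ] ℝ) := by
    rw [← LinearMap.toContinuousLinearMap.finrank_eq]
    exact (Subspace.dual_finrank_eq).symm
  exact ⟨(LinearEquiv.ofInjectiveOfFinrankEq _ hinj hd).toContinuousLinearEquiv, by ext; rfl⟩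

lemma coord_christoffel (g : PseudoRiemannianMetric E M) (x : M) (u v w : E) :
    g.coord x x (g.christoffel x u v) w = g.christoffelFirst x u v w := by
  unfold christoffel
  rw [(g.isInvertible_coord x).self_apply_inverse]

/-- The Levi-Civita connection is compatible with the metric:
`u (g(Y, Z)) = g(∇_u Y, Z) + g(Y, ∇_u Z)`. -/
theorem leviCivita_metric (g : PseudoRiemannianMetric E M) {x : M}
    {Y Z : Π z : M, TangentSpace 𝓘(ℝ, E) z} (hY : MDiffAt (T% Y) x) (hZ : MDiffAt (T% Z) x)
    (u : TangentSpace 𝓘(ℝ, E) x) :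
    mvfderiv 𝓘(ℝ, E) (fun z ↦ g.val z (Y z) (Z z)) x u
      = g.val x (g.leviCivita Y x u) (Z x) + g.val x (Y x) (g.leviCivita Z x u) := by
  have h1 : (fun z ↦ g.val z (Y z) (Z z)) =ᶠ[𝓝 x]
      fun z ↦ g.coord x z (fieldCoord x Y z) (fieldCoord x Z z) := by
    have := (trivializationAt E (TangentSpace 𝓘(ℝ, E)) x).open_baseSet.mem_nhds
      (FiberBundle.mem_baseSet_trivializationAt E _ x)
    filter_upwards [this] with z hz
    rw [coord_apply, symmL_fieldCoord hz, symmL_fieldCoord hz]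
  have hG := g.hasMFDerivAt_coord x
  have hY' : HasMFDerivAt 𝓘(ℝ, E) 𝓘(ℝ, E) (fieldCoord x Y) x (fieldDeriv (E := E) x Y) :=
    (mdiff_fieldCoord hY).hasMFDerivAt
  have hZ' : HasMFDerivAt 𝓘(ℝ, E) 𝓘(ℝ, E) (fieldCoord x Z) x (fieldDeriv (E := E) x Z) :=
    (mdiff_fieldCoord hZ).hasMFDerivAt
  have h2 := hasMFDerivAt_clm_apply (hasMFDerivAt_clm_apply hG hY') hZ'
  refine (congrArg (fun L : E →L[ℝ] ℝ ↦ L u) (h2.congr_of_eventuallyEq h1).mfderiv).trans ?_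
  have hval (v w : E) : g.coord x x v w = g.val x v w := by
    rw [coord, symmL_self]
    rfl
  have key (y z u : E) (A B : E →L[ℝ] E) :
      g.coord x x y (B u) + (g.coord x x (A u) z + g.coordDeriv x u y z)
        = g.coord x x (A u + g.christoffel x u y) z
          + g.coord x x y (B u + g.christoffel x u z) := by
    rw [map_add, map_add, add_apply, coord_christoffel, g.coord_symm x x y (g.christoffel x u z),
      coord_christoffel, christoffelFirst_apply, christoffelFirst_apply,
      g.coordDeriv_symm x u z y, g.coordDeriv_symm x z u y, g.coordDeriv_symm x y u z]
    ring
  have h3 := key (fieldCoord x Y x) (fieldCoord x Z x) u (fieldDeriv x Y) (fieldDeriv x Z)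
  refine h3.trans ?_
  rw [hval, hval]
  have hy := fieldCoord_self x Y
  have hz := fieldCoord_self x Z
  rw [hy, hz]
  rfl

/-- The Levi-Civita connection is torsion-free: `∇_X Y - ∇_Y X = [X, Y]`. -/
theorem leviCivita_torsionFree (g : PseudoRiemannianMetric E M) {x : M}
    {X Y : Π z : M, TangentSpace 𝓘(ℝ, E) z} (hX : MDiffAt (T% X) x) (hY : MDiffAt (T% Y) x) :
    g.leviCivita Y x (X x) - g.leviCivita X x (Y x) = VectorField.mlieBracket 𝓘(ℝ, E) X Y x := by
  have : CompleteSpace E := FiniteDimensional.complete ℝ E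
  refine (CovariantDerivative.torsion_eq_zero_iff _).1 ?_ hX hY
  ext x u v
  rw [CovariantDerivative.torsion_apply_eq_extend, mlieBracket_extend]
  have key (a b s t : E) (h1 : a = 0) (h2 : b = 0) :
      (a + g.christoffel x s t) - (b + g.christoffel x t s) - 0 = 0 := by
    subst h1 h2
    rw [g.christoffel_symm x s t]
    abel
  exact key _ _ _ _ (congr($(fieldDeriv_extend x v) _)) (congr($(fieldDeriv_extend x u) _))


/-- The tangent space `T_pM` (in Mathlib, as a vector space, a copy of the model space `E`) regarded
as a manifold with the constant metric `g_p`. -/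
def tangentSpaceMetric (g : PseudoRiemannianMetric E M) (p : M) : PseudoRiemannianMetric E E :=
  constMetric (g.val p) (g.symm p) (g.nondegenerate p)

end PseudoRiemannianMetric

section Connection

variable (E) in
/-- The velocity `γ'(t)` of the curve `γ` in `M`. -/
def velocity (γ : ℝ → M) (t : ℝ) : TangentSpace 𝓘(ℝ, E) (γ t) :=
  mfderiv 𝓘(ℝ, ℝ) 𝓘(ℝ, E) γ t (1 : ℝ)

namespace CovariantDerivative

variable (cov : CovariantDerivative 𝓘(ℝ, E) E (TangentSpace 𝓘(ℝ, E) : M → Type _))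

/-- The curvature `R(X, Y) Z = ∇_X ∇_Y Z - ∇_Y ∇_X Z - ∇_[X, Y] Z`. -/
def curvature (X Y Z : Π z : M, TangentSpace 𝓘(ℝ, E) z) (x : M) : TangentSpace 𝓘(ℝ, E) x :=
  cov (fun z ↦ cov Z z (Y z)) x (X x) - cov (fun z ↦ cov Z z (X z)) x (Y x)
    - cov Z x (VectorField.mlieBracket 𝓘(ℝ, E) X Y x)

/-- The curvature vanishes at every point of `W`. As `R` is a tensor, on a Hausdorff manifold this is
tested by globally defined smooth vector fields. -/
def CurvatureVanishesOn (W : Set M) : Prop :=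
  ∀ X Y Z : Π z : M, TangentSpace 𝓘(ℝ, E) z,
    CMDiff ∞ (T% X) → CMDiff ∞ (T% Y) → CMDiff ∞ (T% Z) → ∀ q ∈ W, cov.curvature X Y Z q = 0

/-- The covariant derivative `(γ^*∇)_{d/dt} V` of a vector field `V` along the curve `γ`, at time `t`.
In the coordinate frame `∂_i` of the preferred chart at `γ t`, with `V s = ∑ V^i(s) ∂_i(γ s)`, it is
`∑ (dV^i/dt)(t) ∂_i + ∑ V^i(t) ∇_{γ'(t)} ∂_i`. The second sum is the derivative in the direction `γ'(t)`
of the field `FiberBundle.extend E (V t)`, which has in this frame the constant coefficients `V^i(t)`. -/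
def alongCurve (γ : ℝ → M) (V : Π t : ℝ, TangentSpace 𝓘(ℝ, E) (γ t)) (t : ℝ) :
    TangentSpace 𝓘(ℝ, E) (γ t) :=
  let D : E :=
    deriv (fun s ↦ (trivializationAt E (TangentSpace 𝓘(ℝ, E)) (γ t) ⟨γ s, V s⟩).2) t
  let C : E := cov (FiberBundle.extend E (V t)) (γ t) (velocity E γ t)
  D + C

/-- `γ` is a geodesic on the open interval `J`: it is smooth there and its velocity is covariantly
constant along it. -/
structure IsGeodesicOn (γ : ℝ → M) (J : Set ℝ) : Prop where
  contMDiffOn : ContMDiffOn 𝓘(ℝ, ℝ) 𝓘(ℝ, E) ∞ γ J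
  alongCurve_velocity : ∀ t ∈ J, cov.alongCurve γ (velocity E γ) t = 0

/-- `γ` is a geodesic, defined on an open interval around `[0, 1]`, with `γ(0) = p` and `γ'(0) = v`. -/
def IsExpCurve (p : M) (v : TangentSpace 𝓘(ℝ, E) p) (γ : ℝ → M) : Prop :=
  (∃ a b : ℝ, a < 0 ∧ 1 < b ∧ cov.IsGeodesicOn γ (Ioo a b)) ∧
    (⟨γ 0, velocity E γ 0⟩ : TangentBundle 𝓘(ℝ, E) M) = ⟨p, v⟩

/-- The domain of the exponential map at `p`: the tangent vectors `v` for which the geodesic with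
initial velocity `v` exists up to time `1`. -/
def expDomain (p : M) : Set (TangentSpace 𝓘(ℝ, E) p) := {v | ∃ γ : ℝ → M, cov.IsExpCurve p v γ}

open Classical in
/-- The exponential map at `p`: `exp_p(v) = γ(1)` for the geodesic `γ` with `γ(0) = p` and
`γ'(0) = v` (on a Hausdorff manifold it is unique), with a junk value outside of `expDomain p`. -/
def expMap (p : M) (v : TangentSpace 𝓘(ℝ, E) p) : M :=
  if h : ∃ γ : ℝ → M, cov.IsExpCurve p v γ then h.choose 1 else p

end CovariantDerivative

end Connection

variable {N : Type*} [TopologicalSpace N] [ChartedSpace E N]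

variable (E) in
/-- The restriction of `f` to the open set `U` is a smooth diffeomorphism onto its image (an open
set, with smooth inverse). -/
def IsDiffeomorphOntoImage (f : M → N) (U : Set M) : Prop :=
  ∃ Φ : PartialDiffeomorph 𝓘(ℝ, E) 𝓘(ℝ, E) M N ∞, Φ.source = U ∧ EqOn f Φ U

variable [IsManifold 𝓘(ℝ, E) ∞ N]
/-- The restriction of `f` to the open set `U` is an isometry onto its image: a diffeomorphism
whose derivative at every point preserves the pseudo-Euclidean structures on the tangent spaces. -/
structure IsIsometryOntoImage (g : PseudoRiemannianMetric E M) (h : PseudoRiemannianMetric E N)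
    (f : M → N) (U : Set M) : Prop where
  diffeo : IsDiffeomorphOntoImage E f U
  preserves : ∀ x ∈ U, ∀ v w : TangentSpace 𝓘(ℝ, E) x,
    h.val (f x) (mfderiv 𝓘(ℝ, E) 𝓘(ℝ, E) f x v) (mfderiv 𝓘(ℝ, E) 𝓘(ℝ, E) f x w) = g.val x v w

end

/-! Write `h` for the metric pulled back to `U` by `exp_p`, and `Γ` for its Christoffel symbols.
Being an isometry means that `h` is constantly `g_p`. Then `Γ = 0`, and the coordinate formula for
the curvature (`curvature_paramDeriv`) gives `R = 0`.

Conversely, let `R = 0`. Rays from `0` are geodesics of `h`, so `Γ_y(y, y) = 0`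
(`formChristoffel_expParam_self`). Along `t ↦ t x` the field `t w` is a Jacobi field, and in the
absence of curvature its covariant derivative `W_w(t) = w + Γ_{tx}(tx, w)` is parallel. Hence
`h(W_w, W_z)` is constant, equal to `h_0(w, z)`; integrating twice, `h(t w, W_z) = t h_0(w, z)` and
`h(t w, t z) = t² h_0(w, z)`. At `t = 1` this says `h_x = h_0` (`form_eq_of_flat_of_radial`), and
`h_0 = g_p` because the derivative of `exp_p` at `0` is the identity.

The rest carries the connection, its curvature and its geodesics over to a parametrization `Φ`, by
the transformation law `paramDeriv_formChristoffel`, and shows by uniqueness of geodesics that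
`exp_p(t v) = γ_v(t)`. -/

noncomputable section

/-! ### Christoffel symbols of a field of bilinear forms on a vector space -/

section FormField

set_option maxSynthPendingDepth 3

variable {E : Type*} [NormedAddCommGroup E] [NormedSpace ℝ E]

/-- The trilinear form `(u, v, w) ↦ (1/2) (T(u, v, w) + T(v, u, w) - T(w, u, v))`. -/
def koszulForm (T : E →L[ℝ] E →L[ℝ] E →L[ℝ] ℝ) : E →L[ℝ] E →L[ℝ] E →L[ℝ] ℝ :=
  (2⁻¹ : ℝ) • (T + T.flip -
    ((ContinuousLinearMap.flipₗᵢ ℝ E E ℝ).toContinuousLinearEquiv.toContinuousLinearMap).comp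
      T.flip)

lemma koszulForm_apply (T : E →L[ℝ] E →L[ℝ] E →L[ℝ] ℝ) (u v w : E) :
    koszulForm T u v w = 2⁻¹ * (T u v w + T v u w - T w u v) := by
  simp [koszulForm]

lemma contDiff_koszulForm : ContDiff ℝ ∞ (koszulForm (E := E)) := by
  unfold koszulForm
  have h : ContDiff ℝ ∞ fun T : E →L[ℝ] E →L[ℝ] E →L[ℝ] ℝ ↦ T.flip :=
    (ContinuousLinearMap.flipₗᵢ ℝ E E (E →L[ℝ] ℝ)).contDiff
  exact ((contDiff_id.add h).sub (contDiff_const.clm_comp h)).const_smul _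

/-- The Christoffel symbols `Γ(u, v)` at `y` of the field `h` of bilinear forms. -/
def formChristoffel (h : E → E →L[ℝ] E →L[ℝ] ℝ) (y : E) : E →L[ℝ] E →L[ℝ] E :=
  (ContinuousLinearMap.compL ℝ E (E →L[ℝ] ℝ) E (h y).inverse).comp (koszulForm (fderiv ℝ h y))

lemma formChristoffel_apply (h : E → E →L[ℝ] E →L[ℝ] ℝ) (y u v : E) :
    formChristoffel h y u v = (h y).inverse (koszulForm (fderiv ℝ h y) u v) := rfl

lemma apply_formChristoffel {h : E → E →L[ℝ] E →L[ℝ] ℝ} {y : E} (hy : (h y).IsInvertible)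
    (u v w : E) : h y (formChristoffel h y u v) w
      = 2⁻¹ * (fderiv ℝ h y u v w + fderiv ℝ h y v u w - fderiv ℝ h y w u v) := by
  rw [formChristoffel_apply, hy.self_apply_inverse, koszulForm_apply]

/-- Nondegeneracy makes the Koszul formula a characterisation; the transformation law is verified
through it. -/
lemma formChristoffel_eq {h : E → E →L[ℝ] E →L[ℝ] ℝ} {y : E} (hy : (h y).IsInvertible)
    {u v a : E} (ha : ∀ w, h y a w
      = 2⁻¹ * (fderiv ℝ h y u v w + fderiv ℝ h y v u w - fderiv ℝ h y w u v)) :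
    formChristoffel h y u v = a := by
  apply hy.injective
  ext w
  rw [apply_formChristoffel hy, ha]

lemma fderiv_form_symm {h : E → E →L[ℝ] E →L[ℝ] ℝ} {y : E} (hd : DifferentiableAt ℝ h y)
    (hs : ∀ᶠ z in 𝓝 y, ∀ v w, h z v w = h z w v) (u v w : E) :
    fderiv ℝ h y u v w = fderiv ℝ h y u w v := by
  have key (v w : E) : HasFDerivAt (fun z ↦ h z v w)
      (((ContinuousLinearMap.apply ℝ ℝ w).comp
        (ContinuousLinearMap.apply ℝ (E →L[ℝ] ℝ) v)).comp (fderiv ℝ h y)) y :=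
    ((ContinuousLinearMap.apply ℝ ℝ w).comp
      (ContinuousLinearMap.apply ℝ (E →L[ℝ] ℝ) v)).hasFDerivAt.comp y hd.hasFDerivAt
  have h1 := (key v w).congr_of_eventuallyEq (f₁ := fun z ↦ h z w v)
    (hs.mono fun z hz ↦ hz w v)
  exact congr($(h1.unique (key w v)) u)

lemma formChristoffel_symm {h : E → E →L[ℝ] E →L[ℝ] ℝ} {y : E} (hd : DifferentiableAt ℝ h y)
    (hs : ∀ᶠ z in 𝓝 y, ∀ v w, h z v w = h z w v) (u v : E) :
    formChristoffel h y u v = formChristoffel h y v u := by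
  rw [formChristoffel_apply, formChristoffel_apply]
  congr 1
  ext w
  rw [koszulForm_apply, koszulForm_apply, fderiv_form_symm hd hs w u v]
  ring

/-- This is `∇h = 0` in coordinates: in the sum of the two Koszul expressions the symmetry of `h`
cancels everything except twice the derivative in direction `u`. -/
lemma fderiv_form_eq_christoffel {h : E → E →L[ℝ] E →L[ℝ] ℝ} {y : E}
    (hy : (h y).IsInvertible) (hd : DifferentiableAt ℝ h y)
    (hs : ∀ᶠ z in 𝓝 y, ∀ v w, h z v w = h z w v) (u v w : E) :
    fderiv ℝ h y u v w
      = h y (formChristoffel h y u v) w + h y v (formChristoffel h y u w) := by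
  rw [hs.self_of_nhds v, apply_formChristoffel hy, apply_formChristoffel hy,
    fderiv_form_symm hd hs u w v, fderiv_form_symm hd hs w u v, fderiv_form_symm hd hs v u w]
  ring

lemma contDiffAt_formChristoffel [FiniteDimensional ℝ E] {h : E → E →L[ℝ] E →L[ℝ] ℝ} {y : E}
    (hy : (h y).IsInvertible) (hd : ContDiffAt ℝ ∞ h y) :
    ContDiffAt ℝ ∞ (formChristoffel h) y := by
  have : CompleteSpace E := FiniteDimensional.complete ℝ E
  have h1 : ContDiffAt ℝ ∞ (fun z ↦ (h z).inverse) y :=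
    ContDiffAt.comp y (hy.contDiffAt_map_inverse) hd
  have h2 : ContDiffAt ℝ ∞ (fderiv ℝ h) y := hd.fderiv_right (by simp)
  exact ((ContinuousLinearMap.compL ℝ E (E →L[ℝ] ℝ) E).contDiff.contDiffAt.comp y h1).clm_comp
    (contDiff_koszulForm.contDiffAt.comp y h2)

lemma formChristoffel_eq_zero {h : E → E →L[ℝ] E →L[ℝ] ℝ} {y : E} {B : E →L[ℝ] E →L[ℝ] ℝ}
    (hB : h =ᶠ[𝓝 y] fun _ ↦ B) : formChristoffel h y = 0 := by
  ext u v
  have h0 : fderiv ℝ h y = 0 := by rw [hB.fderiv_eq]; simp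
  have h1 : koszulForm (fderiv ℝ h y) u v = 0 := by
    ext w
    simp [koszulForm_apply, h0]
  rw [formChristoffel_apply, h1]
  simp

/-- The curvature tensor `R(u, v) w` at `y` of the connection `∇_u w = ∂_u w + Γ(u, w)`. -/
def formCurvature (Γ : E → E →L[ℝ] E →L[ℝ] E) (y u v w : E) : E :=
  fderiv ℝ Γ y u v w - fderiv ℝ Γ y v u w + Γ y u (Γ y v w) - Γ y v (Γ y u w)

lemma hasDerivAt_bilin_along {F : Type*} [NormedAddCommGroup F] [NormedSpace ℝ F]
    {L : E → E →L[ℝ] E →L[ℝ] F} {c A B : ℝ → E} {c' A' B' : E} {t : ℝ}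
    (hd : DifferentiableAt ℝ L (c t))
    (hc : HasDerivAt c c' t) (hA : HasDerivAt A A' t) (hB : HasDerivAt B B' t) :
    HasDerivAt (fun s ↦ L (c s) (A s) (B s))
      (fderiv ℝ L (c t) c' (A t) (B t) + L (c t) A' (B t) + L (c t) (A t) B') t :=
  ((hd.hasFDerivAt.comp_hasDerivAt t hc).clm_apply hA).clm_apply hB

/-- The product rule for a parallel metric: `A' + Γ(c', A)` is the covariant derivative of `A` along
`c`. -/
lemma hasDerivAt_form_along {h : E → E →L[ℝ] E →L[ℝ] ℝ} {Γ : E →L[ℝ] E →L[ℝ] E} {c A B : ℝ → E}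
    {c' A' B' : E} {t : ℝ} (hd : DifferentiableAt ℝ h (c t))
    (hcompat : ∀ u v w, fderiv ℝ h (c t) u v w = h (c t) (Γ u v) w + h (c t) v (Γ u w))
    (hc : HasDerivAt c c' t) (hA : HasDerivAt A A' t) (hB : HasDerivAt B B' t) :
    HasDerivAt (fun s ↦ h (c s) (A s) (B s))
      (h (c t) (A' + Γ c' (A t)) (B t) + h (c t) (A t) (B' + Γ c' (B t))) t := by
  refine (hasDerivAt_bilin_along hd hc hA hB).congr_deriv ?_
  simp only [add_apply, map_add, hcompat]
  ring

/-- Derivatives are asked for only at interior times, as the parallel transport equation below is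
obtained by dividing by `t`. -/
lemma eq_of_hasDerivAt_zero {f : ℝ → ℝ} (hf : ContinuousOn f (Icc 0 1))
    (hf' : ∀ t ∈ Ioo (0 : ℝ) 1, HasDerivAt f 0 t) {t : ℝ} (ht : t ∈ Icc (0 : ℝ) 1) :
    f t = f 0 := by
  rcases ht.1.eq_or_lt with rfl | h0
  · rfl
  obtain ⟨c, _, hc⟩ := exists_hasDerivAt_eq_slope f (fun _ ↦ 0) h0
    (hf.mono (Icc_subset_Icc_right ht.2)) fun s hs ↦ hf' s ⟨hs.1, hs.2.trans_le ht.2⟩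
  rw [eq_div_iff (by linarith)] at hc
  linarith

/-- A metric on a star-shaped open set that is flat and for which the rays from `0` are geodesics
is constant. -/
theorem form_eq_of_flat_of_radial {U : Set E} (hU : IsOpen U) (hstar : StarConvex ℝ 0 U)
    {h : E → E →L[ℝ] E →L[ℝ] ℝ} {Γ : E → E →L[ℝ] E →L[ℝ] E}
    (hh : ∀ y ∈ U, DifferentiableAt ℝ h y) (hhs : ∀ y ∈ U, ∀ u v, h y u v = h y v u)
    (hΓ : ∀ y ∈ U, DifferentiableAt ℝ Γ y)
    (hsymm : ∀ y ∈ U, ∀ u v, Γ y u v = Γ y v u)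
    (hcompat : ∀ y ∈ U, ∀ u v w, fderiv ℝ h y u v w = h y (Γ y u v) w + h y v (Γ y u w))
    (hrad : ∀ y ∈ U, Γ y y y = 0) (hflat : ∀ y ∈ U, ∀ u v w, formCurvature Γ y u v w = 0)
    {x : E} (hx : x ∈ U) : h x = h 0 := by
  have hmem (t : ℝ) (ht : t ∈ Icc (0 : ℝ) 1) : t • x ∈ U := by
    exact hstar.smul_mem hx ht.1 ht.2
  have hcurve (t : ℝ) : HasDerivAt (fun s : ℝ ↦ s • x) x t := by
    simpa using (hasDerivAt_id t).smul_const x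
  -- The identity `Γ_z(z, z) = 0` differentiated at `y` in direction `w`.
  have hrad' (y : E) (hy : y ∈ U) (w : E) :
      fderiv ℝ Γ y w y y + Γ y y w + Γ y y w = 0 := by
    have h1 := ((hΓ y hy).hasFDerivAt.clm_apply (hasFDerivAt_id y)).clm_apply (hasFDerivAt_id y)
    have h2 : HasFDerivAt (fun z ↦ Γ z z z) (0 : E →L[ℝ] E) y :=
      (hasFDerivAt_const 0 y).congr_of_eventuallyEq <| by
        filter_upwards [hU.mem_nhds hy] with z hz using hrad z hz
    have h3 := congr($(h1.unique h2) w)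
    simp at h3
    rw [hsymm y hy w y] at h3
    rw [← h3]
    abel
  -- The covariant derivative of `t w` along the ray, with the factor `t` moved to the other
  -- argument of `Γ`. The ordinary derivative of `W w` is `W' w`.
  let W (w : E) (t : ℝ) : E := w + Γ (t • x) (t • x) w
  let W' (w : E) (t : ℝ) : E := fderiv ℝ Γ (t • x) x (t • x) w + Γ (t • x) x w
  have hW (w : E) (t : ℝ) (ht : t ∈ Icc (0 : ℝ) 1) : HasDerivAt (W w) (W' w t) t := by
    refine ((hasDerivAt_bilin_along (c := fun s ↦ s • x) (hΓ _ (hmem t ht)) (hcurve t) (hcurve t)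
      (hasDerivAt_const t w)).const_add w).congr_deriv ?_
    simp [W']
  -- `W w` is parallel along the ray. With `y = t x`, adding the differentiated radial identity to
  -- `R(y, w) y = 0` gives `t` times this equation.
  have hpar (w : E) (t : ℝ) (ht : t ∈ Ioo (0 : ℝ) 1) : W' w t + Γ (t • x) x (W w t) = 0 := by
    have hy := hmem t ⟨ht.1.le, ht.2.le⟩
    have h1 := hflat _ hy (t • x) w (t • x)
    have h2 := hrad' _ hy w
    rw [formCurvature, hrad _ hy, hsymm _ hy w (t • x), map_zero, sub_zero] at h1
    have hsymm' (a : E) : fderiv ℝ Γ (t • x) a w (t • x) = fderiv ℝ Γ (t • x) a (t • x) w := by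
      have k (u v : E) := (((hΓ _ hy).hasFDerivAt.clm_apply (hasFDerivAt_const u _)).clm_apply
        (hasFDerivAt_const v _))
      have k1 := (k w (t • x)).congr_of_eventuallyEq (f₁ := fun z ↦ Γ z (t • x) w) <| by
        filter_upwards [hU.mem_nhds hy] with z hz using hsymm z hz _ _
      have k2 := congr($(k1.unique (k (t • x) w)) a)
      simpa using k2
    rw [hsymm'] at h1
    have h3 : t • (W' w t + Γ (t • x) x (W w t)) = 0 := by
      have h4 : t • (W' w t + Γ (t • x) x (W w t))
          = fderiv ℝ Γ (t • x) (t • x) (t • x) w + Γ (t • x) (t • x) w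
            + (Γ (t • x) (t • x) w + Γ (t • x) (t • x) (Γ (t • x) (t • x) w)) := by
        simp only [W, W', map_add, map_smul, smul_apply, smul_add]
      rw [h4]
      linear_combination (norm := module) h1 + h2
    exact (smul_eq_zero.1 h3).resolve_left ht.1.ne'
  have hcont {A B : ℝ → E} (hA : ∀ t ∈ Icc (0 : ℝ) 1, ContinuousAt A t)
      (hB : ∀ t ∈ Icc (0 : ℝ) 1, ContinuousAt B t) :
      ContinuousOn (fun t : ℝ ↦ h (t • x) (A t) (B t)) (Icc 0 1) := fun t ht ↦ by
    have h1 : ContinuousAt (fun t : ℝ ↦ h (t • x)) t :=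
      ContinuousAt.comp (f := fun t : ℝ ↦ t • x) (hh _ (hmem t ht)).continuousAt
        (hcurve t).continuousAt
    exact ((h1.clm_apply (hA t ht)).clm_apply (hB t ht)).continuousWithinAt
  have hWc (w : E) (t : ℝ) (ht : t ∈ Icc (0 : ℝ) 1) : ContinuousAt (W w) t :=
    (hW w t ht).continuousAt
  have hLc (w : E) (t : ℝ) (ht : t ∈ Icc (0 : ℝ) 1) : ContinuousAt (fun t : ℝ ↦ t • w) t := by
    fun_prop
  have hL (w : E) (t : ℝ) : HasDerivAt (fun s : ℝ ↦ s • w) w t := by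
    simpa using (hasDerivAt_id t).smul_const w
  have hLW (w : E) (t : ℝ) : w + Γ (t • x) x (t • w) = W w t := by simp [W]
  ext w z
  -- Parallel fields have constant inner product, and `W w 0 = w`.
  have s1 (w z : E) (t : ℝ) (ht : t ∈ Icc (0 : ℝ) 1) : h (t • x) (W w t) (W z t) = h 0 w z := by
    refine (eq_of_hasDerivAt_zero (hcont (hWc w) (hWc z)) (fun t ht ↦ ?_) ht).trans (by simp [W])
    have ht' := Ioo_subset_Icc_self ht
    refine (hasDerivAt_form_along (hh _ (hmem t ht')) (hcompat _ (hmem t ht')) (hcurve t)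
      (hW w t ht') (hW z t ht')).congr_deriv ?_
    simp [hpar _ t ht]
  -- The derivative of the left side is `h (t • x) (W w t) (W z t)`, constant by `s1`.
  have s2 (w z : E) (t : ℝ) (ht : t ∈ Icc (0 : ℝ) 1) :
      h (t • x) (t • w) (W z t) = t * h 0 w z := by
    have := eq_of_hasDerivAt_zero
      ((hcont (hLc w) (hWc z)).sub (continuousOn_id.mul (continuousOn_const (c := h 0 w z))))
      (fun t ht ↦ ?_) ht
    · simp only [Pi.sub_apply, Pi.mul_apply, id, zero_smul, map_smul, smul_apply,
        smul_eq_mul] at this ⊢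
      linarith
    have ht' := Ioo_subset_Icc_self ht
    refine ((hasDerivAt_form_along (hh _ (hmem t ht')) (hcompat _ (hmem t ht')) (hcurve t)
      (hL w t) (hW z t ht')).sub ((hasDerivAt_id t).mul_const (h 0 w z))).congr_deriv ?_
    rw [hpar _ t ht, hLW, s1 w z t ht']
    simp
  -- By `s2` and the symmetry of `h`, the derivative of the left side is `2 t h 0 w z`.
  have s3 (t : ℝ) (ht : t ∈ Icc (0 : ℝ) 1) :
      h (t • x) (t • w) (t • z) = t ^ 2 * h 0 w z := by
    have := eq_of_hasDerivAt_zero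
      ((hcont (hLc w) (hLc z)).sub
        ((continuousOn_id.pow 2).mul (continuousOn_const (c := h 0 w z))))
      (fun t ht ↦ ?_) ht
    · simp only [Pi.sub_apply, Pi.mul_apply, Pi.pow_apply, id, zero_smul, map_smul, smul_apply,
        smul_eq_mul] at this ⊢
      linarith
    have ht' := Ioo_subset_Icc_self ht
    refine ((hasDerivAt_form_along (hh _ (hmem t ht')) (hcompat _ (hmem t ht')) (hcurve t)
      (hL w t) (hL z t)).sub (((hasDerivAt_id t).pow 2).mul_const (h 0 w z))).congr_deriv ?_
    have hsy : h (t • x) (W w t) (t • z) = t * h 0 w z := by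
      rw [hhs _ (hmem t ht'), s2 z w t ht', hhs 0 (by simpa using hmem 0 (by simp))]
    rw [hLW, hLW, s2 w z t ht', hsy]
    simp
    ring
  simpa using s3 1 (by simp)

end FormField

/-! ### The Levi-Civita connection in a local parametrization -/

section Parametrization


set_option maxSynthPendingDepth 3

variable {E : Type*} [NormedAddCommGroup E] [NormedSpace ℝ E]
    {M : Type*} [TopologicalSpace M] [ChartedSpace E M] [IsManifold 𝓘(ℝ, E) ∞ M]

/-- The derivative at `y` of the local parametrization `Φ`. -/
def paramDeriv (Φ : E → M) (y : E) : E →L[ℝ] E := mfderiv 𝓘(ℝ, E) 𝓘(ℝ, E) Φ y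

/-- The local parametrization `Φ` in the preferred chart at `x`. -/
def chartRep (x : M) (Φ : E → M) (y : E) : E := extChartAt 𝓘(ℝ, E) x (Φ y)

namespace IsLocalDiffeomorphAt

variable {Φ : E → M} {y : E}

lemma eventually_isLocalDiffeomorphAt (hΦ : IsLocalDiffeomorphAt 𝓘(ℝ, E) 𝓘(ℝ, E) ∞ Φ y) :
    ∀ᶠ z in 𝓝 y, IsLocalDiffeomorphAt 𝓘(ℝ, E) 𝓘(ℝ, E) ∞ Φ z := by
  obtain ⟨Ψ, hy, h⟩ := hΦ
  filter_upwards [Ψ.open_source.mem_nhds hy] with z hz using ⟨Ψ, hz, h⟩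

lemma isInvertible_paramDeriv (hΦ : IsLocalDiffeomorphAt 𝓘(ℝ, E) 𝓘(ℝ, E) ∞ Φ y) :
    (paramDeriv Φ y).IsInvertible :=
  ⟨hΦ.mfderivToContinuousLinearEquiv (by simp), rfl⟩

lemma contDiffAt_chartRep (hΦ : IsLocalDiffeomorphAt 𝓘(ℝ, E) 𝓘(ℝ, E) ∞ Φ y) {x : M}
    (hx : Φ y ∈ (chartAt E x).source) : ContDiffAt ℝ ∞ (chartRep x Φ) y :=
  ((contMDiffAt_extChartAt' hx).comp y hΦ.contMDiffAt).contDiffAt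

lemma eventually_mem_source (hΦ : IsLocalDiffeomorphAt 𝓘(ℝ, E) 𝓘(ℝ, E) ∞ Φ y) {x : M}
    (hx : Φ y ∈ (chartAt E x).source) : ∀ᶠ z in 𝓝 y, Φ z ∈ (chartAt E x).source :=
  hΦ.contMDiffAt.continuousAt.eventually ((chartAt E x).open_source.mem_nhds hx)

/-- The trivialization of the tangent bundle at `x` is the derivative of the chart at `x`, so this
is the chain rule. -/
lemma fderiv_chartRep (hΦ : IsLocalDiffeomorphAt 𝓘(ℝ, E) 𝓘(ℝ, E) ∞ Φ y) {x : M}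
    (hx : Φ y ∈ (chartAt E x).source) (u : E) :
    fderiv ℝ (chartRep x Φ) y u = (trivializationAt E (TangentSpace 𝓘(ℝ, E)) x).continuousLinearMapAt
      ℝ (Φ y) (paramDeriv Φ y u) := by
  have h := mfderiv_comp y (mdifferentiableAt_extChartAt (I := 𝓘(ℝ, E)) hx)
    (hΦ.mdifferentiableAt (by simp))
  rw [mfderiv_eq_fderiv, ← TangentBundle.continuousLinearMapAt_trivializationAt hx] at h
  exact congr($h u)

lemma fderiv_chartRep_self (hΦ : IsLocalDiffeomorphAt 𝓘(ℝ, E) 𝓘(ℝ, E) ∞ Φ y) :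
    fderiv ℝ (chartRep (Φ y) Φ) y = paramDeriv Φ y := by
  have hx : Φ y ∈ (chartAt E (Φ y)).source := mem_chart_source E (Φ y)
  ext u
  rw [hΦ.fderiv_chartRep hx, TangentBundle.continuousLinearMapAt_trivializationAt_eq_core hx]
  exact tangentCoordChange_self (I := 𝓘(ℝ, E)) (x := Φ y) (z := Φ y) (v := paramDeriv Φ y u)
    (by simp)

lemma symmL_fderiv_chartRep (hΦ : IsLocalDiffeomorphAt 𝓘(ℝ, E) 𝓘(ℝ, E) ∞ Φ y) {x : M}
    (hx : Φ y ∈ (chartAt E x).source) (u : E) :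
    (trivializationAt E (TangentSpace 𝓘(ℝ, E)) x).symmL ℝ (Φ y) (fderiv ℝ (chartRep x Φ) y u)
      = paramDeriv Φ y u := by
  rw [hΦ.fderiv_chartRep hx]
  exact (trivializationAt E (TangentSpace 𝓘(ℝ, E)) x).symmL_continuousLinearMapAt (R := ℝ) hx _

lemma isInvertible_fderiv_chartRep (hΦ : IsLocalDiffeomorphAt 𝓘(ℝ, E) 𝓘(ℝ, E) ∞ Φ y) :
    (fderiv ℝ (chartRep (Φ y) Φ) y).IsInvertible := by
  rw [hΦ.fderiv_chartRep_self]
  exact hΦ.isInvertible_paramDeriv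

lemma fieldCoord_eq (hΦ : IsLocalDiffeomorphAt 𝓘(ℝ, E) 𝓘(ℝ, E) ∞ Φ y) {x : M}
    (hx : Φ y ∈ (chartAt E x).source) {σ : Π z : M, TangentSpace 𝓘(ℝ, E) z} {u : E}
    (hu : σ (Φ y) = paramDeriv Φ y u) :
    fieldCoord x σ (Φ y) = fderiv ℝ (chartRep x Φ) y u := by
  rw [hΦ.fderiv_chartRep hx, ← hu]
  exact congrFun ((trivializationAt E (TangentSpace 𝓘(ℝ, E)) x).coe_linearMapAt_of_mem
    (R := ℝ) hx).symm (σ (Φ y))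

/-- A vector-valued function on `M` may be differentiated in a local parametrization. -/
lemma mvfderiv_apply {F : Type*} [NormedAddCommGroup F] [NormedSpace ℝ F]
    (hΦ : IsLocalDiffeomorphAt 𝓘(ℝ, E) 𝓘(ℝ, E) ∞ Φ y) {k : M → F} {f : E → F}
    (hk : ∀ᶠ z in 𝓝 y, k (Φ z) = f z) (hf : DifferentiableAt ℝ f y) (u : E) :
    mvfderiv 𝓘(ℝ, E) k (Φ y) (paramDeriv Φ y u) = fderiv ℝ f y u := by
  have hinv : hΦ.localInverse (Φ y) = y := hΦ.localInverse_left_inv hΦ.localInverse_mem_target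
  -- Differentiability of `k` comes from this factorisation; the value then follows from the chain
  -- rule for `k ∘ Φ`.
  have h1 : k =ᶠ[𝓝 (Φ y)] f ∘ hΦ.localInverse := by
    have hc := (hΦ.localInverse_contMDiffAt).continuousAt
    rw [ContinuousAt, hinv] at hc
    filter_upwards [hc.eventually hk, hΦ.localInverse_eventuallyEq_right] with q hq hq'
    rw [Function.comp_apply, ← hq]
    exact congrArg k hq'.symm
  have hf' : MDifferentiableAt 𝓘(ℝ, E) 𝓘(ℝ, F) f (hΦ.localInverse (Φ y)) := by
    rw [hinv]; exact hf.mdifferentiableAt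
  have h2 : MDifferentiableAt 𝓘(ℝ, E) 𝓘(ℝ, F) k (Φ y) :=
    (hf'.comp (Φ y) (hΦ.localInverse_mdifferentiableAt (by simp))).congr_of_eventuallyEq h1
  have h3 := mfderiv_comp y h2 (hΦ.mdifferentiableAt (by simp))
  have h4 : k ∘ Φ =ᶠ[𝓝 y] f := hk
  rw [h4.mfderiv_eq, mfderiv_eq_fderiv] at h3
  exact congr($h3 u).symm

end IsLocalDiffeomorphAt

namespace PseudoRiemannianMetric

/-- The metric `g` in the local parametrization `Φ`. -/
def pullbackForm (g : PseudoRiemannianMetric E M) (Φ : E → M) (y : E) : E →L[ℝ] E →L[ℝ] ℝ :=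
  let B : E →L[ℝ] E →L[ℝ] ℝ := g.val (Φ y)
  B.bilinearComp (paramDeriv Φ y) (paramDeriv Φ y)

lemma pullbackForm_apply (g : PseudoRiemannianMetric E M) (Φ : E → M) (y u v : E) :
    g.pullbackForm Φ y u v = g.val (Φ y) (paramDeriv Φ y u) (paramDeriv Φ y v) := rfl

lemma pullbackForm_symm (g : PseudoRiemannianMetric E M) (Φ : E → M) (y u v : E) :
    g.pullbackForm Φ y u v = g.pullbackForm Φ y v u :=
  g.symm (Φ y) (paramDeriv Φ y u) (paramDeriv Φ y v)

/-- `paramDeriv Φ y` is read in the preferred chart at `Φ y`, which may jump as `y` moves. Freezing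
the chart at `x` expresses the form through functions that can be differentiated. -/
lemma pullbackForm_eq_coord (g : PseudoRiemannianMetric E M) {Φ : E → M} {y : E}
    (hΦ : IsLocalDiffeomorphAt 𝓘(ℝ, E) 𝓘(ℝ, E) ∞ Φ y) {x : M}
    (hx : Φ y ∈ (chartAt E x).source) (u v : E) :
    g.pullbackForm Φ y u v
      = g.coord x (Φ y) (fderiv ℝ (chartRep x Φ) y u) (fderiv ℝ (chartRep x Φ) y v) := by
  rw [coord_apply, hΦ.symmL_fderiv_chartRep hx, hΦ.symmL_fderiv_chartRep hx, pullbackForm_apply]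

lemma contDiffAt_coord_comp (g : PseudoRiemannianMetric E M) {Φ : E → M} {y : E}
    (hΦ : IsLocalDiffeomorphAt 𝓘(ℝ, E) 𝓘(ℝ, E) ∞ Φ y) :
    ContDiffAt ℝ ∞ (fun z ↦ g.coord (Φ y) (Φ z)) y :=
  ((g.contMDiffAt_coord (Φ y)).comp y hΦ.contMDiffAt).contDiffAt

lemma fderiv_coord_comp (g : PseudoRiemannianMetric E M) {Φ : E → M} {y : E}
    (hΦ : IsLocalDiffeomorphAt 𝓘(ℝ, E) 𝓘(ℝ, E) ∞ Φ y) (u : E) :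
    fderiv ℝ (fun z ↦ g.coord (Φ y) (Φ z)) y u = g.coordDeriv (Φ y) (paramDeriv Φ y u) :=
  (hΦ.mvfderiv_apply (Filter.Eventually.of_forall fun _ ↦ rfl)
    ((g.contDiffAt_coord_comp hΦ).differentiableAt (by simp)) u).symm

lemma contDiffAt_fderiv_chartRep {Φ : E → M} {y : E}
    (hΦ : IsLocalDiffeomorphAt 𝓘(ℝ, E) 𝓘(ℝ, E) ∞ Φ y) :
    ContDiffAt ℝ ∞ (fderiv ℝ (chartRep (Φ y) Φ)) y :=
  (hΦ.contDiffAt_chartRep (mem_chart_source E (Φ y))).fderiv_right (by simp)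

lemma contDiffAt_pullbackForm (g : PseudoRiemannianMetric E M) {Φ : E → M} {y : E}
    (hΦ : IsLocalDiffeomorphAt 𝓘(ℝ, E) 𝓘(ℝ, E) ∞ Φ y) :
    ContDiffAt ℝ ∞ (g.pullbackForm Φ) y := by
  have hG := g.contDiffAt_coord_comp hΦ
  have hK := contDiffAt_fderiv_chartRep hΦ
  have hflip : ContDiff ℝ ∞ fun T : E →L[ℝ] E →L[ℝ] ℝ ↦ T.flip :=
    (ContinuousLinearMap.flipₗᵢ ℝ E E ℝ).contDiff
  refine ContDiffAt.congr_of_eventuallyEq (hflip.contDiffAt.comp y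
    ((hflip.contDiffAt.comp y (hG.clm_comp hK)).clm_comp hK)) ?_
  filter_upwards [hΦ.eventually_isLocalDiffeomorphAt,
    hΦ.eventually_mem_source (mem_chart_source E (Φ y))] with z hz hz'
  ext u v
  exact g.pullbackForm_eq_coord hz hz' u v

variable [FiniteDimensional ℝ E]

lemma isInvertible_pullbackForm (g : PseudoRiemannianMetric E M) {Φ : E → M} {y : E}
    (hΦ : IsLocalDiffeomorphAt 𝓘(ℝ, E) 𝓘(ℝ, E) ∞ Φ y) : (g.pullbackForm Φ y).IsInvertible := by
  have hinj : Function.Injective (g.pullbackForm Φ y : E →ₗ[ℝ] E →L[ℝ] ℝ) := by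
    rw [injective_iff_map_eq_zero]
    intro v hv
    refine hΦ.isInvertible_paramDeriv.injective ?_
    rw [map_zero]
    refine g.nondegenerate (Φ y) _ fun w ↦ ?_
    obtain ⟨w, rfl⟩ := hΦ.isInvertible_paramDeriv.surjective w
    exact congr($hv w)
  have hd : Module.finrank ℝ E = Module.finrank ℝ (E →L[ℝ] ℝ) := by
    rw [← LinearMap.toContinuousLinearMap.finrank_eq]
    exact (Subspace.dual_finrank_eq).symm
  exact ⟨(LinearEquiv.ofInjectiveOfFinrankEq _ hinj hd).toContinuousLinearEquiv, by ext; rfl⟩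

/-- The product rule in the chart frozen at `Φ y`; at `y` itself the Jacobian of `chartRep` is
`paramDeriv Φ y`. -/
lemma fderiv_pullbackForm (g : PseudoRiemannianMetric E M) {Φ : E → M} {y : E}
    (hΦ : IsLocalDiffeomorphAt 𝓘(ℝ, E) 𝓘(ℝ, E) ∞ Φ y) (u v w : E) :
    fderiv ℝ (g.pullbackForm Φ) y u v w
      = g.coordDeriv (Φ y) (paramDeriv Φ y u) (paramDeriv Φ y v) (paramDeriv Φ y w)
        + g.coord (Φ y) (Φ y) (fderiv ℝ (fderiv ℝ (chartRep (Φ y) Φ)) y u v) (paramDeriv Φ y w)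
        + g.coord (Φ y) (Φ y) (paramDeriv Φ y v)
          (fderiv ℝ (fderiv ℝ (chartRep (Φ y) Φ)) y u w) := by
  have hK := ((contDiffAt_fderiv_chartRep hΦ).differentiableAt (by simp)).hasFDerivAt
  have h1 := (((g.contDiffAt_coord_comp hΦ).differentiableAt (by simp)).hasFDerivAt.clm_apply
    (hK.clm_apply (hasFDerivAt_const v y))).clm_apply (hK.clm_apply (hasFDerivAt_const w y))
  have h2 := (((g.contDiffAt_pullbackForm hΦ).differentiableAt (by simp)).hasFDerivAt.clm_apply
    (hasFDerivAt_const v y)).clm_apply (hasFDerivAt_const w y)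
  have h3 := h1.congr_of_eventuallyEq (f₁ := fun z ↦ g.pullbackForm Φ z v w) <| by
    filter_upwards [hΦ.eventually_isLocalDiffeomorphAt,
      hΦ.eventually_mem_source (mem_chart_source E (Φ y))] with z hz hz'
    exact g.pullbackForm_eq_coord hz hz' v w
  have h4 := congr($(h2.unique h3) u)
  simp [hΦ.fderiv_chartRep_self, g.fderiv_coord_comp hΦ] at h4
  rw [h4]
  ring

/-- The transformation law of the Christoffel symbols. -/
lemma paramDeriv_formChristoffel (g : PseudoRiemannianMetric E M) {Φ : E → M} {y : E}
    (hΦ : IsLocalDiffeomorphAt 𝓘(ℝ, E) 𝓘(ℝ, E) ∞ Φ y) (u v : E) :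
    paramDeriv Φ y (formChristoffel (g.pullbackForm Φ) y u v)
      = fderiv ℝ (fderiv ℝ (chartRep (Φ y) Φ)) y u v
        + g.christoffel (Φ y) (paramDeriv Φ y u) (paramDeriv Φ y v) := by
  obtain ⟨a, ha⟩ := hΦ.isInvertible_paramDeriv.surjective
    (fderiv ℝ (fderiv ℝ (chartRep (Φ y) Φ)) y u v
        + g.christoffel (Φ y) (paramDeriv Φ y u) (paramDeriv Φ y v))
  rw [← ha]
  congr 1
  refine formChristoffel_eq (g.isInvertible_pullbackForm hΦ) fun w ↦ ?_
  -- By this symmetry all second-derivative terms in the Koszul combination cancel, except the two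
  -- equal ones in the directions `u, v`.
  have hs (u v : E) : fderiv ℝ (fderiv ℝ (chartRep (Φ y) Φ)) y u v
      = fderiv ℝ (fderiv ℝ (chartRep (Φ y) Φ)) y v u :=
    ((hΦ.contDiffAt_chartRep (mem_chart_source E (Φ y))).isSymmSndFDerivAt
      (by
        rw [minSmoothness_of_isRCLikeNormedField]; exact WithTop.coe_le_coe.2 le_top)) u v
  rw [g.pullbackForm_eq_coord hΦ (mem_chart_source E (Φ y)), hΦ.fderiv_chartRep_self, ha,
    map_add, add_apply, coord_christoffel, christoffelFirst_apply, g.fderiv_pullbackForm hΦ,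
    g.fderiv_pullbackForm hΦ, g.fderiv_pullbackForm hΦ, hs v u, hs w u, hs w v,
    g.coord_symm _ _ (paramDeriv Φ y u), g.coord_symm _ _ (paramDeriv Φ y v)]
  ring

/-- The Levi-Civita connection in a local parametrization. -/
lemma leviCivita_paramDeriv (g : PseudoRiemannianMetric E M) {Φ : E → M} {y : E}
    (hΦ : IsLocalDiffeomorphAt 𝓘(ℝ, E) 𝓘(ℝ, E) ∞ Φ y) {σ : Π z : M, TangentSpace 𝓘(ℝ, E) z}
    {ζ : E → E} (hζ : DifferentiableAt ℝ ζ y)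
    (hσ : ∀ᶠ z in 𝓝 y, σ (Φ z) = paramDeriv Φ z (ζ z)) (u : E) :
    g.leviCivita σ (Φ y) (paramDeriv Φ y u)
      = paramDeriv Φ y (fderiv ℝ ζ y u + formChristoffel (g.pullbackForm Φ) y u (ζ y)) := by
  have hK := ((contDiffAt_fderiv_chartRep hΦ).differentiableAt (by simp)).hasFDerivAt
  have h1 := hK.clm_apply hζ.hasFDerivAt
  have h2 : fieldDeriv (Φ y) σ (paramDeriv Φ y u)
      = fderiv ℝ (fderiv ℝ (chartRep (Φ y) Φ)) y u (ζ y) + paramDeriv Φ y (fderiv ℝ ζ y u) := by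
    refine (hΦ.mvfderiv_apply ?_ h1.differentiableAt u).trans ?_
    · filter_upwards [hσ, hΦ.eventually_isLocalDiffeomorphAt,
        hΦ.eventually_mem_source (mem_chart_source E (Φ y))] with z hz hz' hz''
      exact hz'.fieldCoord_eq hz'' hz
    · rw [h1.fderiv]
      simp [hΦ.fderiv_chartRep_self, add_comm]
  refine (g.leviCivita_apply σ (Φ y) (paramDeriv Φ y u)).trans ?_
  rw [h2, map_add, g.paramDeriv_formChristoffel hΦ, hσ.self_of_nhds]
  abel

lemma contDiffAt_formChristoffel_pullbackForm (g : PseudoRiemannianMetric E M) {Φ : E → M} {y : E}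
    (hΦ : IsLocalDiffeomorphAt 𝓘(ℝ, E) 𝓘(ℝ, E) ∞ Φ y) :
    ContDiffAt ℝ ∞ (formChristoffel (g.pullbackForm Φ)) y :=
  contDiffAt_formChristoffel (g.isInvertible_pullbackForm hΦ) (g.contDiffAt_pullbackForm hΦ)

lemma formChristoffel_pullbackForm_symm (g : PseudoRiemannianMetric E M) {Φ : E → M} {y : E}
    (hΦ : IsLocalDiffeomorphAt 𝓘(ℝ, E) 𝓘(ℝ, E) ∞ Φ y) (u v : E) :
    formChristoffel (g.pullbackForm Φ) y u v = formChristoffel (g.pullbackForm Φ) y v u :=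
  formChristoffel_symm ((g.contDiffAt_pullbackForm hΦ).differentiableAt (by simp))
    (Filter.Eventually.of_forall fun _ ↦ g.pullbackForm_symm Φ _) u v

end PseudoRiemannianMetric

end Parametrization

/-! ### Curvature in a local parametrization -/

section ParametrizedCurvature

set_option maxSynthPendingDepth 3

variable {E : Type*} [NormedAddCommGroup E] [NormedSpace ℝ E] [FiniteDimensional ℝ E]
    {M : Type*} [TopologicalSpace M] [ChartedSpace E M] [IsManifold 𝓘(ℝ, E) ∞ M]

/-- A smooth vector field is smooth in every local parametrization. -/
lemma exists_contDiffAt_paramDeriv {Φ : E → M} {y : E}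
    (hΦ : IsLocalDiffeomorphAt 𝓘(ℝ, E) 𝓘(ℝ, E) ∞ Φ y) {X : Π z : M, TangentSpace 𝓘(ℝ, E) z}
    (hX : CMDiff ∞ (T% X)) :
    ∃ ξ : E → E, ContDiffAt ℝ ∞ ξ y ∧ ∀ᶠ z in 𝓝 y, X (Φ z) = paramDeriv Φ z (ξ z) := by
  have : CompleteSpace E := FiniteDimensional.complete ℝ E
  have hx := mem_chart_source E (Φ y)
  have h1 : ContDiffAt ℝ ∞ (fun z ↦ fieldCoord (Φ y) X (Φ z)) y := by
    have h := hX (Φ y)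
    rw [Bundle.contMDiffAt_section] at h
    exact (ContMDiffAt.comp (g := fieldCoord (Φ y) X) y h hΦ.contMDiffAt).contDiffAt
  have hK := PseudoRiemannianMetric.contDiffAt_fderiv_chartRep hΦ
  have hinv := hΦ.isInvertible_fderiv_chartRep
  -- The components solve a linear system in the frozen chart; inversion is smooth at invertible
  -- maps, and these form an open set.
  refine ⟨fun z ↦ (fderiv ℝ (chartRep (Φ y) Φ) z).inverse (fieldCoord (Φ y) X (Φ z)),
    (ContDiffAt.comp y hinv.contDiffAt_map_inverse hK).clm_apply h1, ?_⟩
  have hev : ∀ᶠ z in 𝓝 y, (fderiv ℝ (chartRep (Φ y) Φ) z).IsInvertible := by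
    obtain ⟨e, he⟩ := hinv
    filter_upwards [hK.continuousAt.eventually (he ▸ e.nhds)] with z hz
    exact hz
  filter_upwards [hΦ.eventually_isLocalDiffeomorphAt, hΦ.eventually_mem_source hx, hev]
    with z hz hz' hz''
  rw [← hz.symmL_fderiv_chartRep hz', hz''.self_apply_inverse, symmL_fieldCoord hz']

namespace PseudoRiemannianMetric

/-- Holding on a neighbourhood, and not only at `y`, the formula can be differentiated covariantly
once more. -/
lemma covariantDerivative_paramDeriv (g : PseudoRiemannianMetric E M) {Φ : E → M} {y : E}
    (hΦ : IsLocalDiffeomorphAt 𝓘(ℝ, E) 𝓘(ℝ, E) ∞ Φ y) {Y Z : Π z : M, TangentSpace 𝓘(ℝ, E) z}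
    {η ζ : E → E} (hζ : ContDiffAt ℝ ∞ ζ y)
    (hY : ∀ᶠ z in 𝓝 y, Y (Φ z) = paramDeriv Φ z (η z))
    (hZ : ∀ᶠ z in 𝓝 y, Z (Φ z) = paramDeriv Φ z (ζ z)) :
    ∀ᶠ z in 𝓝 y, g.leviCivita Z (Φ z) (Y (Φ z)) = paramDeriv Φ z
      (fderiv ℝ ζ z (η z) + formChristoffel (g.pullbackForm Φ) z (η z) (ζ z)) := by
  have hζ' : ∀ᶠ z in 𝓝 y, DifferentiableAt ℝ ζ z :=
    ((hζ.of_le (m := 1) (by simp)).eventually (by simp)).mono fun z hz ↦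
      hz.differentiableAt (by simp)
  filter_upwards [hΦ.eventually_isLocalDiffeomorphAt, hζ', hY, hZ.eventually_nhds]
    with z hz h1 h2 h3
  rw [h2]
  exact g.leviCivita_paramDeriv hz h1 h3 _

/-- The curvature of the Levi-Civita connection in a local parametrization. -/
lemma curvature_paramDeriv (g : PseudoRiemannianMetric E M) {Φ : E → M} {y : E}
    (hΦ : IsLocalDiffeomorphAt 𝓘(ℝ, E) 𝓘(ℝ, E) ∞ Φ y) {X Y Z : Π z : M, TangentSpace 𝓘(ℝ, E) z}
    (hXs : CMDiff ∞ (T% X)) (hYs : CMDiff ∞ (T% Y))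
    {ξ η ζ : E → E} (hξ : ContDiffAt ℝ ∞ ξ y) (hη : ContDiffAt ℝ ∞ η y) (hζ : ContDiffAt ℝ ∞ ζ y)
    (hX : ∀ᶠ z in 𝓝 y, X (Φ z) = paramDeriv Φ z (ξ z))
    (hY : ∀ᶠ z in 𝓝 y, Y (Φ z) = paramDeriv Φ z (η z))
    (hZ : ∀ᶠ z in 𝓝 y, Z (Φ z) = paramDeriv Φ z (ζ z)) :
    g.leviCivita.curvature X Y Z (Φ y)
      = paramDeriv Φ y (formCurvature (formChristoffel (g.pullbackForm Φ)) y (ξ y) (η y) (ζ y)) := by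
  set Γ := formChristoffel (g.pullbackForm Φ) with hΓ
  have hΓd : HasFDerivAt Γ (fderiv ℝ Γ y) y :=
    ((g.contDiffAt_formChristoffel_pullbackForm hΦ).differentiableAt (by simp)).hasFDerivAt
  have d {θ : E → E} (hθ : ContDiffAt ℝ ∞ θ y) : HasFDerivAt θ (fderiv ℝ θ y) y :=
    (hθ.differentiableAt (by simp)).hasFDerivAt
  have d2 : HasFDerivAt (fderiv ℝ ζ) (fderiv ℝ (fderiv ℝ ζ) y) y :=
    ((hζ.fderiv_right (m := ∞) (by simp)).differentiableAt (by simp)).hasFDerivAt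
  have hcov {θ : E → E} (hθ : ContDiffAt ℝ ∞ θ y) :=
    (d2.clm_apply (d hθ)).add ((hΓd.clm_apply (d hθ)).clm_apply (d hζ))
  have e1 := g.leviCivita_paramDeriv hΦ (σ := fun z ↦ g.leviCivita Z z (Y z))
    (hcov hη).differentiableAt (g.covariantDerivative_paramDeriv hΦ hζ hY hZ) (ξ y)
  have e2 := g.leviCivita_paramDeriv hΦ (σ := fun z ↦ g.leviCivita Z z (X z))
    (hcov hξ).differentiableAt (g.covariantDerivative_paramDeriv hΦ hζ hX hZ) (η y)
  -- Absence of torsion turns the bracket into `∇_X Y - ∇_Y X`, in which the symmetric Christoffel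
  -- terms cancel.
  have e3 : VectorField.mlieBracket 𝓘(ℝ, E) X Y (Φ y)
      = paramDeriv Φ y (fderiv ℝ η y (ξ y) - fderiv ℝ ξ y (η y)) := by
    rw [← g.leviCivita_torsionFree ((hXs _).mdifferentiableAt (by simp))
      ((hYs _).mdifferentiableAt (by simp))]
    have h1 := (g.covariantDerivative_paramDeriv hΦ hη hX hY).self_of_nhds
    have h2 := (g.covariantDerivative_paramDeriv hΦ hξ hY hX).self_of_nhds
    refine (congrArg₂ (fun a b : E ↦ a - b) h1 h2).trans ?_
    rw [← map_sub, g.formChristoffel_pullbackForm_symm hΦ (η y) (ξ y)]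
    congr 1
    abel
  have e4 := g.leviCivita_paramDeriv hΦ (d hζ).differentiableAt hZ
    (fderiv ℝ η y (ξ y) - fderiv ℝ ξ y (η y))
  rw [(hcov hη).fderiv] at e1
  rw [(hcov hξ).fderiv] at e2
  have hs : fderiv ℝ (fderiv ℝ ζ) y (ξ y) (η y) = fderiv ℝ (fderiv ℝ ζ) y (η y) (ξ y) :=
    (hζ.isSymmSndFDerivAt (by
        rw [minSmoothness_of_isRCLikeNormedField]; exact WithTop.coe_le_coe.2 le_top)) _ _
  unfold CovariantDerivative.curvature
  rw [hX.self_of_nhds, hY.self_of_nhds, e3]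
  refine (congrArg₂ (fun a b : E ↦ a - b) (congrArg₂ (fun a b : E ↦ a - b) e1 e2) e4).trans ?_
  rw [← map_sub, ← map_sub]
  congr 1
  simp only [formCurvature, ← hΓ, add_apply, ContinuousLinearMap.comp_apply,
    ContinuousLinearMap.flip_apply, Pi.add_apply, map_add, map_sub, sub_apply, hs]
  abel

end PseudoRiemannianMetric

end ParametrizedCurvature

/-! ### Geodesics in a local parametrization, and their uniqueness -/

section Geodesics

set_option maxSynthPendingDepth 3

variable {E : Type*} [NormedAddCommGroup E] [NormedSpace ℝ E]
    {M : Type*} [TopologicalSpace M] [ChartedSpace E M] [IsManifold 𝓘(ℝ, E) ∞ M]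

/-- All tangent spaces are copies of `E`, so vectors at different base points can be compared there.
-/
lemma totalSpace_mk_eq_iff {q q' : M} {v : TangentSpace 𝓘(ℝ, E) q}
    {v' : TangentSpace 𝓘(ℝ, E) q'} :
    (⟨q, v⟩ : TangentBundle 𝓘(ℝ, E) M) = ⟨q', v'⟩ ↔ q = q' ∧ (v : E) = (v' : E) := by
  constructor
  · intro h
    exact ⟨congrArg Bundle.TotalSpace.proj h,
      congrArg (fun z : TangentBundle 𝓘(ℝ, E) M ↦ (z.2 : E)) h⟩
  · rintro ⟨rfl, h⟩
    exact congrArg _ h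

lemma isLocalDiffeomorphAt_extChartAt_symm (x : M) {y : E}
    (hy : y ∈ (extChartAt 𝓘(ℝ, E) x).target) :
    IsLocalDiffeomorphAt 𝓘(ℝ, E) 𝓘(ℝ, E) ∞ (extChartAt 𝓘(ℝ, E) x).symm y :=
  ⟨{ toPartialEquiv := (extChartAt 𝓘(ℝ, E) x).symm
     open_source := isOpen_extChartAt_target x
     open_target := isOpen_extChartAt_source x
     contMDiffOn_toFun := contMDiffOn_extChartAt_symm x
     contMDiffOn_invFun := by
       have h := contMDiffOn_extChartAt (I := 𝓘(ℝ, E)) (n := ∞) (x := x)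
       rwa [← extChartAt_source 𝓘(ℝ, E)] at h }, hy, fun _ _ ↦ rfl⟩

lemma velocity_comp {Φ : E → M} {c : ℝ → E} {γ : ℝ → M} {t : ℝ}
    (hΦ : IsLocalDiffeomorphAt 𝓘(ℝ, E) 𝓘(ℝ, E) ∞ Φ (c t)) (hc : DifferentiableAt ℝ c t)
    (hγ : ∀ᶠ s in 𝓝 t, γ s = Φ (c s)) :
    (velocity E γ t : E) = paramDeriv Φ (c t) (deriv c t) := by
  have h1 := mfderiv_comp t (hΦ.mdifferentiableAt (by simp)) hc.mdifferentiableAt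
  have h2 : γ =ᶠ[𝓝 t] Φ ∘ c := hγ
  rw [← h2.mfderiv_eq, mfderiv_eq_fderiv] at h1
  exact congr($h1 (1 : ℝ))

namespace PseudoRiemannianMetric

variable [FiniteDimensional ℝ E]

/-- The extension of `V t` has constant components in the chart, so only the Christoffel term of its
covariant derivative remains. -/
lemma alongCurve_eq (g : PseudoRiemannianMetric E M) (γ : ℝ → M)
    (V : Π t : ℝ, TangentSpace 𝓘(ℝ, E) (γ t)) (t : ℝ) :
    (g.leviCivita.alongCurve γ V t : E)
      = deriv (fun s ↦ (trivializationAt E (TangentSpace 𝓘(ℝ, E)) (γ t) ⟨γ s, V s⟩).2) t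
        + g.christoffel (γ t) (velocity E γ t) (V t) := by
  have h1 := g.leviCivita_apply (FiberBundle.extend E (V t)) (γ t) (velocity E γ t)
  rw [fieldDeriv_extend, FiberBundle.extend_apply_self] at h1
  refine congrArg₂ (fun a b : E ↦ a + b) rfl (h1.trans ?_)
  exact zero_add _

/-- The acceleration of a curve in a local parametrization. -/
lemma alongCurve_velocity_comp (g : PseudoRiemannianMetric E M) {Φ : E → M} {c : ℝ → E}
    {γ : ℝ → M} {t : ℝ} (hΦ : IsLocalDiffeomorphAt 𝓘(ℝ, E) 𝓘(ℝ, E) ∞ Φ (c t))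
    (hc : ContDiffAt ℝ 2 c t) (hγ : ∀ᶠ s in 𝓝 t, γ s = Φ (c s)) :
    (g.leviCivita.alongCurve γ (velocity E γ) t : E)
      = paramDeriv Φ (c t) (deriv (deriv c) t
        + formChristoffel (g.pullbackForm Φ) (c t) (deriv c t) (deriv c t)) := by
  have hx := mem_chart_source E (Φ (c t))
  have hct : Filter.Tendsto c (𝓝 t) (𝓝 (c t)) := hc.continuousAt
  have hd : ∀ᶠ s in 𝓝 t, DifferentiableAt ℝ c s :=
    (hc.eventually (by simp)).mono fun s hs ↦ hs.differentiableAt (by simp)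
  have h2 : DifferentiableAt ℝ (deriv c) t :=
    ((hc.fderiv_right (m := 1) le_rfl).clm_apply contDiffAt_const).differentiableAt (by simp)
  -- The components of the velocity in one fixed chart. Differentiating them yields a second
  -- derivative of `chartRep`, which the transformation law absorbs.
  have h1 : ∀ᶠ s in 𝓝 t,
      (trivializationAt E (TangentSpace 𝓘(ℝ, E)) (Φ (c t)) ⟨γ s, velocity E γ s⟩).2
        = fderiv ℝ (chartRep (Φ (c t)) Φ) (c s) (deriv c s) := by
    filter_upwards [hct.eventually hΦ.eventually_isLocalDiffeomorphAt,
      hct.eventually (hΦ.eventually_mem_source hx), hγ.eventually_nhds, hd] with s h1 h2 h3 h4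
    have h5 := velocity_comp h1 h4 h3
    have h6 : (⟨γ s, velocity E γ s⟩ : TangentBundle 𝓘(ℝ, E) M)
        = ⟨Φ (c s), paramDeriv Φ (c s) (deriv c s)⟩ :=
      totalSpace_mk_eq_iff.2 ⟨h3.self_of_nhds, h5⟩
    rw [h6, h1.fderiv_chartRep h2]
    exact congrFun ((trivializationAt E (TangentSpace 𝓘(ℝ, E)) (Φ (c t))).coe_linearMapAt_of_mem
      (R := ℝ) h2).symm _
  have hK := ((contDiffAt_fderiv_chartRep hΦ).differentiableAt (by simp)).hasFDerivAt
  have hKc := (hK.comp_hasDerivAt t (hc.differentiableAt (by simp)).hasDerivAt).clm_apply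
    h2.hasDerivAt
  rw [alongCurve_eq, velocity_comp hΦ (hc.differentiableAt (by simp)) hγ, hγ.self_of_nhds,
    Filter.EventuallyEq.deriv_eq h1]
  refine (congrArg (· + _) hKc.deriv).trans ?_
  rw [map_add, g.paramDeriv_formChristoffel hΦ]
  simp only [Function.comp_apply, hΦ.fderiv_chartRep_self]
  abel

end PseudoRiemannianMetric

end Geodesics

/-! ### Uniqueness of geodesics -/

section GeodesicUniqueness

set_option maxSynthPendingDepth 3

variable {E : Type*} [NormedAddCommGroup E] [NormedSpace ℝ E]
    {M : Type*} [TopologicalSpace M] [ChartedSpace E M] [IsManifold 𝓘(ℝ, E) ∞ M]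

lemma contDiffAt_extChartAt_comp {γ : ℝ → M} {t : ℝ} (hγ : ContMDiffAt 𝓘(ℝ, ℝ) 𝓘(ℝ, E) ∞ γ t)
    {x : M} (hx : γ t ∈ (chartAt E x).source) :
    ContDiffAt ℝ ∞ (fun s ↦ extChartAt 𝓘(ℝ, E) x (γ s)) t :=
  ((contMDiffAt_extChartAt' hx).comp t hγ).contDiffAt

lemma eventually_eq_extChartAt_symm {γ : ℝ → M} {t : ℝ}
    (hγ : ContMDiffAt 𝓘(ℝ, ℝ) 𝓘(ℝ, E) ∞ γ t) {x : M} (hx : γ t ∈ (chartAt E x).source) :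
    ∀ᶠ s in 𝓝 t, γ s = (extChartAt 𝓘(ℝ, E) x).symm (extChartAt 𝓘(ℝ, E) x (γ s)) := by
  filter_upwards [hγ.continuousAt.eventually ((chartAt E x).open_source.mem_nhds hx)] with s hs
  exact ((extChartAt 𝓘(ℝ, E) x).left_inv (by rwa [extChartAt_source])).symm

lemma isLocalDiffeomorphAt_extChartAt_symm_apply {x q : M} (hx : q ∈ (chartAt E x).source) :
    IsLocalDiffeomorphAt 𝓘(ℝ, E) 𝓘(ℝ, E) ∞ (extChartAt 𝓘(ℝ, E) x).symm
      (extChartAt 𝓘(ℝ, E) x q) :=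
  isLocalDiffeomorphAt_extChartAt_symm x
    ((extChartAt 𝓘(ℝ, E) x).map_source (by simpa using hx))

namespace PseudoRiemannianMetric

variable [FiniteDimensional ℝ E]

/-- The geodesic equation in a local parametrization. -/
lemma geodesic_equation (g : PseudoRiemannianMetric E M) {Φ : E → M} {c : ℝ → E} {γ : ℝ → M}
    {J : Set ℝ} {t : ℝ} (h : g.leviCivita.IsGeodesicOn γ J) (ht : t ∈ J)
    (hΦ : IsLocalDiffeomorphAt 𝓘(ℝ, E) 𝓘(ℝ, E) ∞ Φ (c t))
    (hc : ContDiffAt ℝ 2 c t) (hγ : ∀ᶠ s in 𝓝 t, γ s = Φ (c s)) :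
    deriv (deriv c) t
      + formChristoffel (g.pullbackForm Φ) (c t) (deriv c t) (deriv c t) = 0 := by
  apply hΦ.isInvertible_paramDeriv.injective
  rw [← g.alongCurve_velocity_comp hΦ hc hγ, map_zero]
  exact h.alongCurve_velocity t ht

/-- The first-order system on `E × E` of the geodesic equation in a local parametrization. -/
def geodesicField (g : PseudoRiemannianMetric E M) (Φ : E → M) (z : E × E) : E × E :=
  (z.2, -formChristoffel (g.pullbackForm Φ) z.1 z.2 z.2)

lemma contDiffAt_geodesicField (g : PseudoRiemannianMetric E M) {Φ : E → M} {z : E × E}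
    (hΦ : IsLocalDiffeomorphAt 𝓘(ℝ, E) 𝓘(ℝ, E) ∞ Φ z.1) :
    ContDiffAt ℝ 1 (g.geodesicField Φ) z := by
  have h1 : ContDiffAt ℝ ∞ (fun z : E × E ↦ formChristoffel (g.pullbackForm Φ) z.1) z :=
    ContDiffAt.comp z (g.contDiffAt_formChristoffel_pullbackForm hΦ) contDiffAt_fst
  exact (contDiffAt_snd.prodMk
    ((h1.clm_apply contDiffAt_snd).clm_apply contDiffAt_snd).neg).of_le (by simp)

lemma eventually_hasDerivAt_geodesicField (g : PseudoRiemannianMetric E M) {γ : ℝ → M}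
    {J : Set ℝ} (hJ : IsOpen J) {t : ℝ} (h : g.leviCivita.IsGeodesicOn γ J) (ht : t ∈ J) {x : M}
    (hx : γ t ∈ (chartAt E x).source) :
    letI c : ℝ → E := fun s ↦ extChartAt 𝓘(ℝ, E) x (γ s)
    ∀ᶠ s in 𝓝 t, HasDerivAt (fun s ↦ (c s, deriv c s))
      (g.geodesicField (extChartAt 𝓘(ℝ, E) x).symm (c s, deriv c s)) s := by
  have hγ (s) (hs : s ∈ J) : ContMDiffAt 𝓘(ℝ, ℝ) 𝓘(ℝ, E) ∞ γ s :=
    h.contMDiffOn.contMDiffAt (hJ.mem_nhds hs)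
  filter_upwards [hJ.mem_nhds ht,
    (hγ t ht).continuousAt.eventually ((chartAt E x).open_source.mem_nhds hx)] with s hs hsx
  have hc := contDiffAt_extChartAt_comp (hγ s hs) hsx
  have hc2 : DifferentiableAt ℝ (deriv fun s ↦ extChartAt 𝓘(ℝ, E) x (γ s)) s :=
    ((hc.fderiv_right (m := ∞) (by simp)).clm_apply contDiffAt_const).differentiableAt (by simp)
  have heq := g.geodesic_equation h hs (isLocalDiffeomorphAt_extChartAt_symm_apply hsx)
    (hc.of_le (WithTop.coe_le_coe.2 le_top)) (eventually_eq_extChartAt_symm (hγ s hs) hsx)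
  refine ((hc.differentiableAt (by simp)).hasDerivAt.prodMk hc2.hasDerivAt).congr_deriv ?_
  rw [geodesicField, Prod.mk.injEq]
  exact ⟨rfl, eq_neg_of_add_eq_zero_left heq⟩

/-- Local uniqueness of geodesics. -/
lemma eventuallyEq_of_isGeodesicOn (g : PseudoRiemannianMetric E M) {γ₁ γ₂ : ℝ → M}
    {J : Set ℝ} (hJ : IsOpen J) {t : ℝ} (ht : t ∈ J) (h₁ : g.leviCivita.IsGeodesicOn γ₁ J)
    (h₂ : g.leviCivita.IsGeodesicOn γ₂ J) (h0 : γ₁ t = γ₂ t)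
    (h0' : deriv (fun s ↦ extChartAt 𝓘(ℝ, E) (γ₁ t) (γ₁ s)) t
      = deriv (fun s ↦ extChartAt 𝓘(ℝ, E) (γ₁ t) (γ₂ s)) t) :
    γ₁ =ᶠ[𝓝 t] γ₂ := by
  have hx₁ : γ₁ t ∈ (chartAt E (γ₁ t)).source := mem_chart_source E (γ₁ t)
  have hx₂ : γ₂ t ∈ (chartAt E (γ₁ t)).source := h0 ▸ hx₁
  have e₁ := g.eventually_hasDerivAt_geodesicField hJ h₁ ht hx₁
  have e₂ := g.eventually_hasDerivAt_geodesicField hJ h₂ ht hx₂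
  -- The field of the first-order system is `C¹`, hence Lipschitz near the common initial value, and
  -- the uniqueness theorem for ODEs applies.
  obtain ⟨K, s, hs, hK⟩ := (g.contDiffAt_geodesicField
    (z := (extChartAt 𝓘(ℝ, E) (γ₁ t) (γ₁ t),
      deriv (fun s ↦ extChartAt 𝓘(ℝ, E) (γ₁ t) (γ₁ s)) t))
    (isLocalDiffeomorphAt_extChartAt_symm_apply hx₁)).exists_lipschitzOnWith
  have hz : (extChartAt 𝓘(ℝ, E) (γ₁ t) (γ₁ t),
      deriv (fun s ↦ extChartAt 𝓘(ℝ, E) (γ₁ t) (γ₁ s)) t) = (extChartAt 𝓘(ℝ, E) (γ₁ t) (γ₂ t),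
      deriv (fun s ↦ extChartAt 𝓘(ℝ, E) (γ₁ t) (γ₂ s)) t) := by rw [← h0', ← h0]
  have hs₂ := hs
  rw [hz] at hs₂
  have hODE := ODE_solution_unique_of_eventually (t₀ := t)
    (v := fun _ ↦ g.geodesicField (extChartAt 𝓘(ℝ, E) (γ₁ t)).symm) (s := fun _ ↦ s)
    (Filter.Eventually.of_forall fun _ ↦ hK)
    (e₁.and (e₁.self_of_nhds.continuousAt.eventually hs))
    (e₂.and (e₂.self_of_nhds.continuousAt.eventually hs₂)) hz
  filter_upwards [hODE,
    eventually_eq_extChartAt_symm (h₁.contMDiffOn.contMDiffAt (hJ.mem_nhds ht)) hx₁,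
    eventually_eq_extChartAt_symm (h₂.contMDiffOn.contMDiffAt (hJ.mem_nhds ht)) hx₂]
    with r hr hr₁ hr₂
  rw [hr₁, hr₂]
  exact congrArg (fun z ↦ (extChartAt 𝓘(ℝ, E) (γ₁ t)).symm z.1) hr

lemma deriv_extChartAt_eq_of_velocity_eq {γ₁ γ₂ : ℝ → M} {t : ℝ}
    (h₁ : ContMDiffAt 𝓘(ℝ, ℝ) 𝓘(ℝ, E) ∞ γ₁ t) (h₂ : ContMDiffAt 𝓘(ℝ, ℝ) 𝓘(ℝ, E) ∞ γ₂ t)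
    (h0 : γ₁ t = γ₂ t) (h0' : (velocity E γ₁ t : E) = (velocity E γ₂ t : E)) :
    deriv (fun s ↦ extChartAt 𝓘(ℝ, E) (γ₁ t) (γ₁ s)) t
      = deriv (fun s ↦ extChartAt 𝓘(ℝ, E) (γ₁ t) (γ₂ s)) t := by
  have hx₁ : γ₁ t ∈ (chartAt E (γ₁ t)).source := mem_chart_source E (γ₁ t)
  have hx₂ : γ₂ t ∈ (chartAt E (γ₁ t)).source := h0 ▸ hx₁
  have hΦ := isLocalDiffeomorphAt_extChartAt_symm_apply hx₁
  have hΦ₂ := isLocalDiffeomorphAt_extChartAt_symm_apply hx₂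
  rw [velocity_comp hΦ ((contDiffAt_extChartAt_comp h₁ hx₁).differentiableAt (by simp))
    (eventually_eq_extChartAt_symm h₁ hx₁), velocity_comp hΦ₂
    ((contDiffAt_extChartAt_comp h₂ hx₂).differentiableAt (by simp))
    (eventually_eq_extChartAt_symm h₂ hx₂), ← h0] at h0'
  exact hΦ.isInvertible_paramDeriv.injective h0'

/-- Uniqueness of geodesics on a Hausdorff manifold. -/
theorem eqOn_of_isGeodesicOn [T2Space M] (g : PseudoRiemannianMetric E M) {γ₁ γ₂ : ℝ → M}
    {J : Set ℝ} (hJ : IsOpen J) (hJ' : IsPreconnected J) {t : ℝ} (ht : t ∈ J)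
    (h₁ : g.leviCivita.IsGeodesicOn γ₁ J)
    (h₂ : g.leviCivita.IsGeodesicOn γ₂ J) (h0 : γ₁ t = γ₂ t)
    (h0' : (velocity E γ₁ t : E) = (velocity E γ₂ t : E)) : EqOn γ₁ γ₂ J := by
  have c₁ (s) (hs : s ∈ J) := h₁.contMDiffOn.contMDiffAt (hJ.mem_nhds hs)
  have c₂ (s) (hs : s ∈ J) := h₂.contMDiffOn.contMDiffAt (hJ.mem_nhds hs)
  -- The times at which the germs agree form an open set; it remains to show that it is closed in
  -- the connected set `J`.
  have hopen : IsOpen {s | γ₁ =ᶠ[𝓝 s] γ₂} := isOpen_setOfPred_eventually_nhds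
  suffices J ⊆ {s | γ₁ =ᶠ[𝓝 s] γ₂} from fun s hs ↦ (this hs).eq_of_nhds
  refine hJ'.subset_of_closure_inter_subset hopen ⟨t, ht, g.eventuallyEq_of_isGeodesicOn hJ ht h₁ h₂
    h0 (deriv_extChartAt_eq_of_velocity_eq (c₁ t ht) (c₂ t ht) h0 h0')⟩ ?_
  rintro s ⟨hs, hsJ⟩
  have hf : ∃ᶠ r in 𝓝 s, γ₁ =ᶠ[𝓝 r] γ₂ := mem_closure_iff_frequently.1 hs
  -- At a limit time the positions agree because `M` is Hausdorff; the chart velocities agree by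
  -- continuity, and local uniqueness applies again.
  have hs0 : γ₁ s = γ₂ s := tendsto_nhds_unique_of_frequently_eq (c₁ s hsJ).continuousAt
    (c₂ s hsJ).continuousAt (hf.mono fun r hr ↦ hr.eq_of_nhds)
  refine g.eventuallyEq_of_isGeodesicOn hJ hsJ h₁ h₂ hs0 ?_
  have hx₁ : γ₁ s ∈ (chartAt E (γ₁ s)).source := mem_chart_source E (γ₁ s)
  have hx₂ : γ₂ s ∈ (chartAt E (γ₁ s)).source := hs0 ▸ hx₁
  have hd {γ : ℝ → M} (hc : ContMDiffAt 𝓘(ℝ, ℝ) 𝓘(ℝ, E) ∞ γ s)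
      (hx : γ s ∈ (chartAt E (γ₁ s)).source) :
      ContinuousAt (deriv fun r ↦ extChartAt 𝓘(ℝ, E) (γ₁ s) (γ r)) s :=
    (((contDiffAt_extChartAt_comp hc hx).fderiv_right (m := ∞) (by simp)).clm_apply
      contDiffAt_const).continuousAt
  refine tendsto_nhds_unique_of_frequently_eq (hd (c₁ s hsJ) hx₁) (hd (c₂ s hsJ) hx₂)
    (hf.mono fun r hr ↦ ?_)
  exact Filter.EventuallyEq.deriv_eq (hr.mono fun a ha ↦ congrArg _ ha)

end PseudoRiemannianMetric

end GeodesicUniqueness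

/-! ### The exponential map along rays -/

section ExponentialMap

set_option maxSynthPendingDepth 3

variable {E : Type*} [NormedAddCommGroup E] [NormedSpace ℝ E] [FiniteDimensional ℝ E]
    {M : Type*} [TopologicalSpace M] [ChartedSpace E M] [IsManifold 𝓘(ℝ, E) ∞ M]

/-- Every tangent vector of a Hausdorff manifold extends to a smooth vector field. -/
lemma exists_contMDiff_vectorField [T2Space M] (q : M) (u : TangentSpace 𝓘(ℝ, E) q) :
    ∃ X : Π z : M, TangentSpace 𝓘(ℝ, E) z, CMDiff ∞ (T% X) ∧ X q = u := by
  obtain ⟨s, hs, hsm⟩ := FiberBundle.exists_contMDiffOn_extend 𝓘(ℝ, E) E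
    (V := (TangentSpace 𝓘(ℝ, E) : M → Type _)) (k := ∞) u
  -- A bump function supported where the local extension is smooth makes that extension global.
  obtain ⟨f, hf, -⟩ := (SmoothBumpFunction.nhds_basis_support (I := 𝓘(ℝ, E))
    (interior_mem_nhds.2 hs)).mem_iff.1 (interior_mem_nhds.2 hs)
  refine ⟨(f : M → ℝ) • FiberBundle.extend E u, f.contMDiff.contMDiffOn.smul_section_of_tsupport
    isOpen_interior hf (hsm.mono interior_subset), ?_⟩
  rw [Pi.smul_apply', f.eq_one, FiberBundle.extend_apply_self, one_smul]

namespace PseudoRiemannianMetric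

/-- Both terms of the geodesic equation are multiplied by `t²`: one is a second derivative, the
other is quadratic in the velocity. -/
lemma isGeodesicOn_comp_mul (g : PseudoRiemannianMetric E M) {γ : ℝ → M} {J J' : Set ℝ} {t : ℝ}
    (hJ : IsOpen J) (h : g.leviCivita.IsGeodesicOn γ J) (hJJ' : ∀ s ∈ J', t * s ∈ J) :
    g.leviCivita.IsGeodesicOn (fun s ↦ γ (t * s)) J' := by
  refine ⟨h.contMDiffOn.comp (t := J)
    (contDiff_const.mul contDiff_id).contMDiff.contMDiffOn hJJ', fun s hs ↦ ?_⟩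
  have hγ := h.contMDiffOn.contMDiffAt (hJ.mem_nhds (hJJ' s hs))
  have hx := mem_chart_source E (γ (t * s))
  have hΦ := isLocalDiffeomorphAt_extChartAt_symm_apply hx
  have hc := contDiffAt_extChartAt_comp hγ hx
  have hev := eventually_eq_extChartAt_symm hγ hx
  have h2 : (2 : WithTop ℕ∞) ≤ ∞ := WithTop.coe_le_coe.2 le_top
  have heq := g.geodesic_equation h (hJJ' s hs) hΦ (hc.of_le h2) hev
  set c : ℝ → E := fun r ↦ extChartAt 𝓘(ℝ, E) (γ (t * s)) (γ r)
  have hcont : Filter.Tendsto (fun r ↦ t * r) (𝓝 s) (𝓝 (t * s)) :=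
    (continuous_const.mul continuous_id).continuousAt
  have d1 : (deriv fun r ↦ c (t * r)) = fun r ↦ t • deriv c (t * r) :=
    funext fun r ↦ deriv_comp_mul_left t c r
  have d2 : deriv (deriv fun r ↦ c (t * r)) s = t • t • deriv (deriv c) (t * s) := by
    rw [d1, deriv_fun_const_smul_field, deriv_comp_mul_left t (deriv c) s]
  have hc' : ContDiffAt ℝ 2 (fun r ↦ c (t * r)) s :=
    ContDiffAt.comp (g := c) s (hc.of_le h2) (contDiff_const.mul contDiff_id).contDiffAt
  have key := g.alongCurve_velocity_comp (γ := fun r ↦ γ (t * r)) hΦ hc' (hcont.eventually hev)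
  rw [d2, congrFun d1 s] at key
  refine key.trans ?_
  rw [map_smul, map_smul, smul_apply, ← smul_add, ← smul_add, heq, smul_zero, smul_zero, map_zero]
  rfl

lemma isExpCurve_comp_mul (g : PseudoRiemannianMetric E M) {p : M} {v : E} {γ : ℝ → M}
    (h : g.leviCivita.IsExpCurve p v γ) {t : ℝ} (ht : t ∈ Icc (0 : ℝ) 1) :
    g.leviCivita.IsExpCurve p (t • v : E) (fun s ↦ γ (t * s)) := by
  obtain ⟨⟨a, b, ha, hb, hgeo⟩, h0⟩ := h
  refine ⟨⟨a, b, ha, hb, g.isGeodesicOn_comp_mul isOpen_Ioo hgeo fun s hs ↦ ?_⟩, ?_⟩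
  -- Scaling time by `t ∈ [0, 1]` maps the interval around `0` into itself, so it need not be
  -- changed.
  · exact ((convex_Ioo a b).starConvex ⟨ha, by linarith⟩).smul_mem hs ht.1 ht.2
  · replace h0 := totalSpace_mk_eq_iff.1 h0
    refine totalSpace_mk_eq_iff.2 ⟨by simpa using h0.1, ?_⟩
    have hγ := hgeo.contMDiffOn.contMDiffAt (Ioo_mem_nhds ha (by linarith : (0 : ℝ) < b))
    have hx := mem_chart_source E (γ 0)
    have hΦ := isLocalDiffeomorphAt_extChartAt_symm_apply hx
    have hc := (contDiffAt_extChartAt_comp hγ hx).differentiableAt (by simp)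
    have hev := eventually_eq_extChartAt_symm hγ hx
    have h1 := velocity_comp hΦ hc hev
    set c : ℝ → E := fun r ↦ extChartAt 𝓘(ℝ, E) (γ 0) (γ r)
    have ht0 : t * 0 = 0 := mul_zero t
    have hcont : Filter.Tendsto (fun r ↦ t * r) (𝓝 0) (𝓝 0) := by
      have : ContinuousAt (fun r ↦ t * r) 0 := (continuous_const.mul continuous_id).continuousAt
      simpa only [ContinuousAt, ht0] using this
    have hc' : DifferentiableAt ℝ (fun r ↦ c (t * r)) 0 :=
      DifferentiableAt.comp (g := c) 0 (by rwa [ht0]) (differentiableAt_id.const_mul t)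
    have h2 := velocity_comp (c := fun r ↦ c (t * r)) (γ := fun r ↦ γ (t * r))
      (by simpa only [ht0] using hΦ) hc' (hcont.eventually hev)
    refine h2.trans ?_
    rw [deriv_comp_mul_left, ht0, map_smul]
    exact congrArg (t • ·) (h1.symm.trans h0.2)

/-- The exponential map at `p` as a map on the model space `E`, of which `T_pM` is a copy. -/
def expParam (g : PseudoRiemannianMetric E M) (p : M) (v : E) : M := g.leviCivita.expMap p v

/-- The geodesic chosen in `expMap` agrees with `γ` on the intersection of their intervals, which
contains both `0` and `1`. -/
lemma expParam_eq [T2Space M] (g : PseudoRiemannianMetric E M) {p : M} {v : E} {γ : ℝ → M}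
    (h : g.leviCivita.IsExpCurve p v γ) : g.expParam p v = γ 1 := by
  have hex : ∃ γ : ℝ → M, g.leviCivita.IsExpCurve p v γ := ⟨γ, h⟩
  have h' := hex.choose_spec
  unfold expParam CovariantDerivative.expMap
  rw [dif_pos hex]
  generalize hex.choose = γ' at h'
  obtain ⟨⟨a, b, ha, hb, hgeo⟩, h0⟩ := h
  obtain ⟨⟨a', b', ha', hb', hgeo'⟩, h0'⟩ := h'
  replace h0 := totalSpace_mk_eq_iff.1 h0
  replace h0' := totalSpace_mk_eq_iff.1 h0'
  have hsub : Ioo (max a a') (min b b') ⊆ Ioo a b :=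
    Ioo_subset_Ioo (le_max_left _ _) (min_le_left _ _)
  have hsub' : Ioo (max a a') (min b b') ⊆ Ioo a' b' :=
    Ioo_subset_Ioo (le_max_right _ _) (min_le_right _ _)
  refine g.eqOn_of_isGeodesicOn isOpen_Ioo isPreconnected_Ioo (t := 0)
    ⟨max_lt ha ha', lt_min (by linarith) (by linarith)⟩
    ⟨hgeo'.contMDiffOn.mono hsub', fun t ht ↦ hgeo'.alongCurve_velocity t (hsub' ht)⟩
    ⟨hgeo.contMDiffOn.mono hsub, fun t ht ↦ hgeo.alongCurve_velocity t (hsub ht)⟩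
    (h0'.1.trans h0.1.symm) (h0'.2.trans h0.2.symm)
    ⟨(max_lt ha ha').trans one_pos, lt_min hb hb'⟩

/-- The curve `s ↦ γ (t s)` is the geodesic with initial velocity `t v`; thus the exponential map
carries rays to geodesics. -/
lemma expParam_smul [T2Space M] (g : PseudoRiemannianMetric E M) {p : M} {v : E} {γ : ℝ → M}
    (h : g.leviCivita.IsExpCurve p v γ) {t : ℝ} (ht : t ∈ Icc (0 : ℝ) 1) :
    g.expParam p (t • v) = γ t := by
  rw [g.expParam_eq (g.isExpCurve_comp_mul h ht), mul_one]

lemma expParam_zero [T2Space M] (g : PseudoRiemannianMetric E M) {p : M} {v : E}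
    (h : v ∈ g.leviCivita.expDomain p) : g.expParam p 0 = p := by
  obtain ⟨γ, h⟩ := h
  have h1 := g.expParam_smul h (t := 0) (by simp)
  rw [zero_smul] at h1
  exact h1.trans (totalSpace_mk_eq_iff.1 h.2).1

/-- Where `exp_p` is a local diffeomorphism, the rays from `0` satisfy the geodesic equation. -/
lemma formChristoffel_expParam_self [T2Space M] (g : PseudoRiemannianMetric E M) (p : M)
    {U : Set E} (hU : IsOpen U) (hdom : U ⊆ g.leviCivita.expDomain p) {y : E} (hy : y ∈ U)
    (hΦ : IsLocalDiffeomorphAt 𝓘(ℝ, E) 𝓘(ℝ, E) ∞ (g.expParam p) y) :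
    formChristoffel (g.pullbackForm (g.expParam p)) y y y = 0 := by
  -- The ray is prolonged beyond `y`, so that `y` lies at the interior time `s⁻¹`: the geodesic is
  -- identified with the ray only on `[0, 1]`, and the equation needs a two-sided neighbourhood.
  obtain ⟨s, hsU, hs⟩ : ∃ s : ℝ, s • y ∈ U ∧ 1 < s := by
    have h1 : ∀ᶠ s : ℝ in 𝓝 1, s • y ∈ U := by
      have : Filter.Tendsto (fun s : ℝ ↦ s • y) (𝓝 1) (𝓝 ((1 : ℝ) • y)) :=
        (continuous_id.smul continuous_const).continuousAt
      exact this.eventually (hU.mem_nhds (by simpa using hy))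
    exact ((h1.filter_mono nhdsWithin_le_nhds).and
      (self_mem_nhdsWithin (s := Ioi (1 : ℝ)))).exists
  obtain ⟨γ, hγ⟩ := hdom hsU
  obtain ⟨a, b, ha, hb, hgeo⟩ := hγ.1
  have hs0 : 0 < s := by linarith
  have ht : s⁻¹ ∈ Ioo (0 : ℝ) 1 := ⟨inv_pos.2 hs0, inv_lt_one_of_one_lt₀ hs⟩
  have hty : s⁻¹ • s • y = y := inv_smul_smul₀ hs0.ne' y
  have hev : ∀ᶠ r in 𝓝 s⁻¹, γ r = g.expParam p (r • s • y) := by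
    filter_upwards [Ioo_mem_nhds ht.1 ht.2] with r hr
    exact (g.expParam_smul hγ (Ioo_subset_Icc_self hr)).symm
  have d1 : (deriv fun r : ℝ ↦ r • s • y) = fun _ ↦ s • y :=
    funext fun r ↦ by simpa using ((hasDerivAt_id r).smul_const (s • y)).deriv
  have h := g.geodesic_equation (Φ := g.expParam p) (c := fun r ↦ r • s • y) hgeo
    (t := s⁻¹) ⟨by linarith [ht.1], by linarith [ht.2]⟩ (by simpa only [hty] using hΦ)
    (contDiff_id.smul contDiff_const).contDiffAt hev
  rw [d1, deriv_const, zero_add] at h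
  simp only [hty, map_smul, smul_apply] at h
  exact (smul_eq_zero.1 ((smul_eq_zero.1 h).resolve_left hs0.ne')).resolve_left hs0.ne'

/-- The derivative of `exp_p` at `0` is the identity. -/
lemma paramDeriv_expParam_zero [T2Space M] (g : PseudoRiemannianMetric E M) (p : M)
    {U : Set E} (hU : U ∈ 𝓝 (0 : E)) (hdom : U ⊆ g.leviCivita.expDomain p)
    (hΦ : IsLocalDiffeomorphAt 𝓘(ℝ, E) 𝓘(ℝ, E) ∞ (g.expParam p) 0) (v : E) :
    paramDeriv (g.expParam p) 0 v = v := by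
  have main (v : E) (hv : v ∈ U) : paramDeriv (g.expParam p) 0 v = v := by
    obtain ⟨γ, hγ⟩ := hdom hv
    obtain ⟨a, b, ha, hb, hgeo⟩ := hγ.1
    obtain ⟨h0, h0'⟩ := totalSpace_mk_eq_iff.1 hγ.2
    have hγc := hgeo.contMDiffOn.contMDiffAt (Ioo_mem_nhds ha (by linarith : (0 : ℝ) < b))
    have hexp : γ 0 = g.expParam p 0 := h0.trans (g.expParam_zero (hdom hv)).symm
    have hinv : hΦ.localInverse (γ 0) = 0 := by
      rw [hexp]; exact hΦ.localInverse_left_inv hΦ.localInverse_mem_target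
    have hinvc : ContMDiffAt 𝓘(ℝ, E) 𝓘(ℝ, E) ∞ hΦ.localInverse (γ 0) := by
      rw [hexp]; exact hΦ.localInverse_contMDiffAt
    -- The geodesic lifted to `E`. It is known to be `s v` only for small `s ≥ 0`; as it is
    -- differentiable at `0`, the one-sided derivative determines its velocity there.
    let c : ℝ → E := fun s ↦ hΦ.localInverse (γ s)
    have hc : DifferentiableAt ℝ c 0 :=
      (hinvc.comp (0 : ℝ) hγc).contDiffAt.differentiableAt (by simp)
    have hc0 : c 0 = 0 := hinv
    have hev : ∀ᶠ s in 𝓝 (0 : ℝ), γ s = g.expParam p (c s) := by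
      have h1 := hγc.continuousAt.tendsto
      rw [hexp] at h1
      filter_upwards [h1.eventually hΦ.localInverse_eventuallyEq_right] with s hs
      exact hs.symm
    have hray : c =ᶠ[𝓝[Icc 0 1] 0] fun s ↦ s • v := by
      have h1 : Filter.Tendsto (fun s : ℝ ↦ s • v) (𝓝 0) (𝓝 0) := by
        have : ContinuousAt (fun s : ℝ ↦ s • v) 0 :=
          (continuous_id.smul continuous_const).continuousAt
        simpa [ContinuousAt] using this
      filter_upwards [nhdsWithin_le_nhds (h1.eventually hΦ.localInverse_eventuallyEq_left),
        self_mem_nhdsWithin] with s hs hs'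
      have h2 := g.expParam_smul hγ hs'
      change hΦ.localInverse (γ s) = s • v
      rw [← h2]
      exact hs
    have hd : deriv c 0 = v := by
      have h1 := hc.hasDerivAt.hasDerivWithinAt (s := Icc 0 1)
      have h2 : HasDerivWithinAt (fun s : ℝ ↦ s • v) v (Icc 0 1) 0 := by
        simpa using ((hasDerivAt_id (0 : ℝ)).smul_const v).hasDerivWithinAt (s := Icc 0 1)
      exact (uniqueDiffOn_Icc zero_lt_one 0 (by simp)).eq_deriv _ h1
        (h2.congr_of_eventuallyEq hray (by simp [hc0]))
    have h1 := velocity_comp (Φ := g.expParam p) (c := c) (hc0.symm ▸ hΦ) hc hev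
    rw [hc0, hd] at h1
    exact h1.symm.trans h0'
  -- An arbitrary vector is scaled into `U`, and linearity removes the factor.
  have hsmall : ∀ᶠ s : ℝ in 𝓝[>] 0, s • v ∈ U := by
    have : ContinuousAt (fun s : ℝ ↦ s • v) 0 := (continuous_id.smul continuous_const).continuousAt
    refine nhdsWithin_le_nhds (this.eventually ?_)
    simpa using hU
  obtain ⟨s, hs, hs0⟩ := (hsmall.and self_mem_nhdsWithin).exists
  have h1 := main _ hs
  rw [map_smul] at h1
  exact smul_right_injective E (ne_of_gt hs0) h1

/-! ### Flatness and constancy of the metric coefficients -/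

lemma val_congr (g : PseudoRiemannianMetric E M) {q q' : M} (h : q = q') (u v : E) :
    g.val q u v = g.val q' u v := by
  subst h; rfl

/-- A metric with constant coefficients in a local parametrization is flat. -/
lemma curvatureVanishesOn_image (g : PseudoRiemannianMetric E M) {Φ : E → M} {U : Set E}
    (hU : IsOpen U) (hΦ : ∀ y ∈ U, IsLocalDiffeomorphAt 𝓘(ℝ, E) 𝓘(ℝ, E) ∞ Φ y)
    {B : E →L[ℝ] E →L[ℝ] ℝ} (hB : ∀ y ∈ U, g.pullbackForm Φ y = B) :
    g.leviCivita.CurvatureVanishesOn (Φ '' U) := by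
  rintro X Y Z hX hY hZ _ ⟨y, hy, rfl⟩
  have hΓ (z : E) (hz : z ∈ U) : formChristoffel (g.pullbackForm Φ) z = 0 :=
    formChristoffel_eq_zero (Filter.eventually_of_mem (hU.mem_nhds hz) hB)
  obtain ⟨ξ, hξ, hXξ⟩ := exists_contDiffAt_paramDeriv (hΦ y hy) hX
  obtain ⟨η, hη, hYη⟩ := exists_contDiffAt_paramDeriv (hΦ y hy) hY
  obtain ⟨ζ, hζ, hZζ⟩ := exists_contDiffAt_paramDeriv (hΦ y hy) hZ
  refine (g.curvature_paramDeriv (hΦ y hy) hX hY hξ hη hζ hXξ hYη hZζ).trans ?_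
  have hd : fderiv ℝ (formChristoffel (g.pullbackForm Φ)) y = 0 := by
    have h0 : formChristoffel (g.pullbackForm Φ) =ᶠ[𝓝 y] fun _ ↦ 0 :=
      Filter.eventually_of_mem (hU.mem_nhds hy) hΓ
    rw [h0.fderiv_eq, fderiv_fun_const, Pi.zero_apply]
  have h0 : formCurvature (formChristoffel (g.pullbackForm Φ)) y (ξ y) (η y) (ζ y) = 0 := by
    simp [formCurvature, hd, hΓ y hy]
  rw [h0, map_zero]
  rfl

/-- The hypothesis concerns global fields, so the three vectors are extended to such; by
`curvature_paramDeriv` only their values at the point matter. -/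
lemma formCurvature_eq_zero [T2Space M] (g : PseudoRiemannianMetric E M) {Φ : E → M} {U : Set E}
    (hcurv : g.leviCivita.CurvatureVanishesOn (Φ '' U)) {y : E} (hy : y ∈ U)
    (hΦ : IsLocalDiffeomorphAt 𝓘(ℝ, E) 𝓘(ℝ, E) ∞ Φ y) (u v w : E) :
    formCurvature (formChristoffel (g.pullbackForm Φ)) y u v w = 0 := by
  obtain ⟨X, hX, hXu⟩ := exists_contMDiff_vectorField (Φ y) (paramDeriv Φ y u)
  obtain ⟨Y, hY, hYv⟩ := exists_contMDiff_vectorField (Φ y) (paramDeriv Φ y v)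
  obtain ⟨Z, hZ, hZw⟩ := exists_contMDiff_vectorField (Φ y) (paramDeriv Φ y w)
  obtain ⟨ξ, hξ, hXξ⟩ := exists_contDiffAt_paramDeriv hΦ hX
  obtain ⟨η, hη, hYη⟩ := exists_contDiffAt_paramDeriv hΦ hY
  obtain ⟨ζ, hζ, hZζ⟩ := exists_contDiffAt_paramDeriv hΦ hZ
  have hinj := hΦ.isInvertible_paramDeriv.injective
  have h1 := g.curvature_paramDeriv hΦ hX hY hξ hη hζ hXξ hYη hZζ
  rw [← hinj (hXu.symm.trans hXξ.self_of_nhds), ← hinj (hYv.symm.trans hYη.self_of_nhds),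
    ← hinj (hZw.symm.trans hZζ.self_of_nhds)] at h1
  refine hinj (h1.symm.trans ?_)
  rw [map_zero]
  exact hcurv X Y Z hX hY hZ _ ⟨y, hy, rfl⟩

/-- On a flat manifold, the metric has constant coefficients in normal coordinates. -/
theorem pullbackForm_expParam_eq [T2Space M] (g : PseudoRiemannianMetric E M) (p : M) {U : Set E}
    (hU : IsOpen U) (hstar : StarConvex ℝ 0 U) (hdom : U ⊆ g.leviCivita.expDomain p)
    (hΦ : ∀ y ∈ U, IsLocalDiffeomorphAt 𝓘(ℝ, E) 𝓘(ℝ, E) ∞ (g.expParam p) y)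
    (hcurv : g.leviCivita.CurvatureVanishesOn (g.expParam p '' U)) {y : E} (hy : y ∈ U) :
    g.pullbackForm (g.expParam p) y = g.val p := by
  have h0 : (0 : E) ∈ U := hstar.mem ⟨y, hy⟩
  have hd (y : E) (hy : y ∈ U) : DifferentiableAt ℝ (g.pullbackForm (g.expParam p)) y :=
    (g.contDiffAt_pullbackForm (hΦ y hy)).differentiableAt (by simp)
  rw [form_eq_of_flat_of_radial hU hstar hd (fun y _ ↦ g.pullbackForm_symm _ y)
    (fun y hy ↦ (g.contDiffAt_formChristoffel_pullbackForm (hΦ y hy)).differentiableAt (by simp))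
    (fun y hy ↦ g.formChristoffel_pullbackForm_symm (hΦ y hy))
    (fun y hy ↦ fderiv_form_eq_christoffel (g.isInvertible_pullbackForm (hΦ y hy)) (hd y hy)
      (Filter.Eventually.of_forall fun z ↦ g.pullbackForm_symm _ z))
    (fun y hy ↦ g.formChristoffel_expParam_self p hU hdom hy (hΦ y hy))
    (fun y hy ↦ g.formCurvature_eq_zero hcurv hy (hΦ y hy)) hy]
  ext u v
  rw [pullbackForm_apply, g.paramDeriv_expParam_zero p (hU.mem_nhds h0) hdom (hΦ 0 h0),
    g.paramDeriv_expParam_zero p (hU.mem_nhds h0) hdom (hΦ 0 h0)]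
  exact g.val_congr (g.expParam_zero (hdom h0)) u v

end PseudoRiemannianMetric

end ExponentialMap

end

theorem mainTheorem8 {E : Type*} [NormedAddCommGroup E] [NormedSpace ℝ E] [FiniteDimensional ℝ E]
    {M : Type*} [TopologicalSpace M] [T2Space M] [ChartedSpace E M] [IsManifold 𝓘(ℝ, E) ∞ M]
    (g : PseudoRiemannianMetric E M) (p : M) (U : Set (TangentSpace 𝓘(ℝ, E) p))
    (hU_open : IsOpen U) (hU_convex : Convex ℝ U) (hU_zero : 0 ∈ U)
    (hU_dom : U ⊆ g.leviCivita.expDomain p)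
    (hU_diffeo : IsDiffeomorphOntoImage E (M := E) (g.leviCivita.expMap p) U) :
    IsIsometryOntoImage (g.tangentSpaceMetric p) g (g.leviCivita.expMap p) U ↔
      g.leviCivita.CurvatureVanishesOn (g.leviCivita.expMap p '' U) := by
  have hΦ (y : E) (hy : y ∈ U) :
      IsLocalDiffeomorphAt 𝓘(ℝ, E) 𝓘(ℝ, E) ∞ (g.expParam p) y := by
    obtain ⟨Ψ, hΨ, heq⟩ := hU_diffeo
    exact ⟨Ψ, hΨ ▸ hy, hΨ ▸ heq⟩
  constructor
  · intro hiso
    exact g.curvatureVanishesOn_image (Φ := g.expParam p) (U := U) (B := g.val p) hU_open hΦ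
      -- Preservation of the metric is literally the constancy of `pullbackForm` on `U`.
      fun y hy ↦ ContinuousLinearMap.ext fun u ↦ ContinuousLinearMap.ext fun v ↦
        hiso.preserves y hy u v
  · intro hcurv
    refine ⟨hU_diffeo, fun y hy w z ↦ ?_⟩
    -- Convexity enters only as star-shapedness about `0`: the argument runs along rays.
    have h := g.pullbackForm_expParam_eq p (U := U) hU_open (hU_convex.starConvex hU_zero) hU_dom
      hΦ hcurv hy
    exact congr($h w z)
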